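/- Let $p\neq 2$ be a prime. A \emph{$p$-adic operator algebra} is a Banach $*$-algebra over $\mathbb{Z}_p$ (complete, with an ultrametric, submultiplicative norm satisfying $\|\lambda a\|=|\lambda|\,\|a\|$ for $\lambda\in\mathbb{Z}_p$, and an isometric involution) that admits, for some set $X$, an isometric $*$-homomorphism into the $*$-algebra $\mathcal{B}(c_0(X,\mathbb{Z}_p))$ of bounded $\mathbb{Z}_p$-linear operators on $c_0(X,\mathbb{Z}_p)$ (sup norm) that have a bounded adjoint for the pairing $\langle\xi,\eta\rangle=\sum_{x}\xi(x)\eta(x)$, equipped with the operator norm $\|T\|=\sup_{\|\xi\|\le 1}\|T\xi\|$. Let $n\ge 0$, let $I$ be an ideal of the Tate algebra $\mathbb{Q}_p\langle x_1,\dots,x_n\rangle$ and suppose that the affinoid algebra $A=\mathbb{Q}_p\langle x_1,\dots,x_n\rangle/I$ is reduced. Equip $A$ with the quotient norm of the Gauss norm, and for every maximal ideal $\mathfrak{m}\subseteq A$ let $\|f+\mathfrak{m}\|$ be the quotient norm on $A/\mathfrak{m}$ of this norm on $A$. (1) If $A\ne 0$, then for each $f\in A$ the maximum $\|f\|=\max_{\mathfrak{m}}\|f+\mathfrak{m}\|$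 over all maximal ideals exists (for $A=0$ put $\|0\|=0$). The unit ball $B=\{f\in A:\|f\|\le 1\}$ is a $\mathbb{Z}_p$-subalgebra of $A$ and, with the trivial involution $f^*=f$ and the norm $\|\cdot\|$, it is a $p$-adic operator algebra. (2) Let $|f|_{\mathrm{sp}}=\sup_{\mathfrak{m}}|f+\mathfrak{m}|$ be the spectral norm of $f\in A$, where $|\cdot|$ on the field $A/\mathfrak{m}$ is the unique absolute value extending the one of $\mathbb{Q}_p$ (for $A=0$ put $|0|_{\mathrm{sp}}=0$). If $|f|_{\mathrm{sp}}\in|\mathbb{Q}_p|$ for all $f\in A$, then $\{f\in A:|f|_{\mathrm{sp}}\le 1\}$ is a $\mathbb{Z}_p$-subalgebra of $A$ and, with the trivial involution and the norm $|\cdot|_{\mathrm{sp}}$, it is a $p$-adic operator algebra. -/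

import Mathlib

open Filter Topology
open scoped ZeroAtInfty

set_option linter.unusedSectionVars false

noncomputable section

namespace PadicOpAlg

universe u

/-! ### The basic p-adic Hilbert space `c₀(X, ℤ_p)` and its adjointable operators -/

section Operators

variable (p : ℕ) [Fact p.Prime] (X : Type u) [TopologicalSpace X] [DiscreteTopology X]

/-- `c₀(X, ℤ_p)`: the functions from the discrete space `X` to `ℤ_p` that vanish at infinity,
with the supremum norm. -/
abbrev C0 : Type u := C₀(X, ℤ_[p])

variable {p X}

/-- The canonical pairing `⟨ξ, η⟩ = ∑ₓ ξ(x) η(x)` (the series converges unconditionally). -/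
def pairing (ξ η : C0 p X) : ℤ_[p] := ∑' x, ξ x * η x

theorem summable_pairing (ξ η : C0 p X) : Summable fun x => ξ x * η x := by
  apply NonarchimedeanAddGroup.summable_of_tendsto_cofinite_zero
  have h := (ξ * η).zero_at_infty'
  rw [cocompact_eq_cofinite] at h
  exact h

theorem pairing_comm (ξ η : C0 p X) : pairing ξ η = pairing η ξ := by
  simp only [pairing, mul_comm]

theorem pairing_add_right (ξ η ζ : C0 p X) :
    pairing ξ (η + ζ) = pairing ξ η + pairing ξ ζ := by
  simp only [pairing, ZeroAtInftyContinuousMap.add_apply, mul_add]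
  exact (summable_pairing ξ η).tsum_add (summable_pairing ξ ζ)

theorem pairing_smul_right (c : ℤ_[p]) (ξ η : C0 p X) :
    pairing ξ (c • η) = c * pairing ξ η := by
  simp only [pairing, ZeroAtInftyContinuousMap.smul_apply, smul_eq_mul, mul_left_comm]
  exact ((summable_pairing ξ η).hasSum.mul_left c).tsum_eq

theorem pairing_add_left (ξ η ζ : C0 p X) :
    pairing (ξ + η) ζ = pairing ξ ζ + pairing η ζ := by
  rw [pairing_comm, pairing_add_right, pairing_comm ζ, pairing_comm ζ]

theorem pairing_smul_left (c : ℤ_[p]) (ξ η : C0 p X) :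
    pairing (c • ξ) η = c * pairing ξ η := by
  rw [pairing_comm, pairing_smul_right, pairing_comm]

/-- The function `δₓ`, equal to `1` at `x` and to `0` elsewhere. -/
def delta [DecidableEq X] (x : X) : C0 p X where
  toFun := Pi.single x 1
  continuous_toFun := continuous_of_discreteTopology
  zero_at_infty' := by
    rw [cocompact_eq_cofinite]
    refine tendsto_nhds_of_eventually_eq ((Set.finite_singleton x).subset ?_)
    intro y hy
    by_contra hne
    exact hy (Pi.single_eq_of_ne hne _)

theorem pairing_delta_left [DecidableEq X] (x : X) (η : C0 p X) :
    pairing (delta x) η = η x := by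
  have h : ∀ y, y ≠ x → (delta x : C0 p X) y * η y = 0 := by
    intro y hy
    have : (delta x : C0 p X) y = 0 := Pi.single_eq_of_ne hy _
    rw [this, zero_mul]
  have h1 : (delta x : C0 p X) x = 1 := Pi.single_eq_same x _
  rw [pairing, tsum_eq_single x h, h1, one_mul]

theorem pairing_nondegenerate {η ζ : C0 p X} (h : ∀ ξ, pairing ξ η = pairing ξ ζ) : η = ζ := by
  classical
  ext x
  rw [← pairing_delta_left x η, ← pairing_delta_left x ζ, h]

/-- `T` is bounded. -/
def IsBdd (T : Module.End ℤ_[p] (C0 p X)) : Prop := ∃ C : ℝ, ∀ ξ, ‖T ξ‖ ≤ C * ‖ξ‖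

/-- `S` is an adjoint of `T`. -/
def IsAdj (T S : Module.End ℤ_[p] (C0 p X)) : Prop :=
  ∀ ξ η, pairing ξ (T η) = pairing (S ξ) η

theorem IsAdj.symm {T S : Module.End ℤ_[p] (C0 p X)} (h : IsAdj T S) : IsAdj S T := by
  intro ξ η
  rw [pairing_comm, ← h, pairing_comm]

theorem IsAdj.unique {T S S' : Module.End ℤ_[p] (C0 p X)} (h : IsAdj T S) (h' : IsAdj T S') :
    S = S' := by
  ext1 ξ
  refine pairing_nondegenerate fun η => ?_
  rw [pairing_comm, ← h, h', pairing_comm]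

theorem IsAdj.add {T S T' S' : Module.End ℤ_[p] (C0 p X)} (h : IsAdj T S) (h' : IsAdj T' S') :
    IsAdj (T + T') (S + S') := by
  intro ξ η
  rw [LinearMap.add_apply, LinearMap.add_apply, pairing_add_right, pairing_add_left, h, h']

theorem IsAdj.mul {T S T' S' : Module.End ℤ_[p] (C0 p X)} (h : IsAdj T S) (h' : IsAdj T' S') :
    IsAdj (T * T') (S' * S) := by
  intro ξ η
  rw [Module.End.mul_apply, Module.End.mul_apply, h, h']

theorem isAdj_algebraMap (c : ℤ_[p]) :
    IsAdj (algebraMap ℤ_[p] (Module.End ℤ_[p] (C0 p X)) c) (algebraMap ℤ_[p] _ c) := by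
  intro ξ η
  rw [Module.algebraMap_end_apply, Module.algebraMap_end_apply, pairing_smul_right,
    pairing_smul_left]

theorem IsBdd.add {T S : Module.End ℤ_[p] (C0 p X)} (hT : IsBdd T) (hS : IsBdd S) :
    IsBdd (T + S) := by
  obtain ⟨C, hC⟩ := hT
  obtain ⟨D, hD⟩ := hS
  refine ⟨C + D, fun ξ => ?_⟩
  rw [LinearMap.add_apply, add_mul]
  exact (norm_add_le _ _).trans (add_le_add (hC ξ) (hD ξ))

theorem IsBdd.mul {T S : Module.End ℤ_[p] (C0 p X)} (hT : IsBdd T) (hS : IsBdd S) :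
    IsBdd (T * S) := by
  obtain ⟨C, hC⟩ := hT
  obtain ⟨D, hD⟩ := hS
  refine ⟨|C| * D, fun ξ => ?_⟩
  rw [Module.End.mul_apply, mul_assoc]
  calc ‖T (S ξ)‖ ≤ C * ‖S ξ‖ := hC _
    _ ≤ |C| * ‖S ξ‖ := mul_le_mul_of_nonneg_right (le_abs_self C) (norm_nonneg _)
    _ ≤ |C| * (D * ‖ξ‖) := mul_le_mul_of_nonneg_left (hD ξ) (abs_nonneg C)

theorem isBdd_algebraMap (c : ℤ_[p]) :
    IsBdd (algebraMap ℤ_[p] (Module.End ℤ_[p] (C0 p X)) c) := by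
  refine ⟨‖c‖, fun ξ => ?_⟩
  rw [Module.algebraMap_end_apply, ← ZeroAtInftyContinuousMap.norm_toBCF_eq_norm,
    BoundedContinuousFunction.norm_le (by positivity)]
  intro x
  change ‖c • ξ x‖ ≤ _
  rw [smul_eq_mul, norm_mul, ← ZeroAtInftyContinuousMap.norm_toBCF_eq_norm]
  exact mul_le_mul_of_nonneg_left (ξ.toBCF.norm_coe_le_norm x) (norm_nonneg c)

variable (p X)

/-- `𝓑(c₀(X, ℤ_p))`: the algebra of the bounded `ℤ_p`-linear operators on `c₀(X, ℤ_p)` that have a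
bounded adjoint for the canonical pairing. -/
def AdjOp : Subalgebra ℤ_[p] (Module.End ℤ_[p] (C0 p X)) where
  carrier := {T | IsBdd T ∧ ∃ S, IsBdd S ∧ IsAdj T S}
  mul_mem' := by
    rintro T T' ⟨hT, S, hS, h⟩ ⟨hT', S', hS', h'⟩
    exact ⟨hT.mul hT', S' * S, hS'.mul hS, h.mul h'⟩
  add_mem' := by
    rintro T T' ⟨hT, S, hS, h⟩ ⟨hT', S', hS', h'⟩
    exact ⟨hT.add hT', S + S', hS.add hS', h.add h'⟩
  algebraMap_mem' c := ⟨isBdd_algebraMap c, _, isBdd_algebraMap c, isAdj_algebraMap c⟩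

variable {p X}

/-- The adjoint `T*` of an adjointable operator `T`. -/
def adj (T : AdjOp p X) : AdjOp p X :=
  ⟨T.2.2.choose, T.2.2.choose_spec.1, T.1, T.2.1, T.2.2.choose_spec.2.symm⟩

theorem isAdj_adj (T : AdjOp p X) : IsAdj T.1 (adj T).1 := T.2.2.choose_spec.2

theorem eq_adj {T S : AdjOp p X} (h : IsAdj T.1 S.1) : adj T = S :=
  Subtype.ext ((isAdj_adj T).unique h)

instance : StarRing (AdjOp p X) where
  star := adj
  star_involutive T := eq_adj (isAdj_adj T).symm
  star_mul T S := eq_adj ((isAdj_adj T).mul (isAdj_adj S))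
  star_add T S := eq_adj ((isAdj_adj T).add (isAdj_adj S))

/-- The operator norm `‖T‖ = sup {‖T ξ‖ : ‖ξ‖ ≤ 1}`. -/
def opNorm (T : AdjOp p X) : ℝ := sSup {r : ℝ | ∃ ξ : C0 p X, ‖ξ‖ ≤ 1 ∧ r = ‖T.1 ξ‖}

end Operators

/-! ### Banach *-algebras over `ℤ_p` and p-adic operator algebras -/

section OperatorAlgebras

variable (p : ℕ) [Fact p.Prime] (B : Type u) [NonUnitalRing B] [StarRing B] [Module ℤ_[p] B]
  [IsScalarTower ℤ_[p] B B] [SMulCommClass ℤ_[p] B B]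

/-- The *-algebra `B` over `ℤ_p` is a (non-Archimedean) Banach *-algebra for the norm `ν`. -/
structure IsBanachStarAlgebra (ν : B → ℝ) : Prop where
  nonneg : ∀ a, 0 ≤ ν a
  eq_zero_iff : ∀ a, ν a = 0 ↔ a = 0
  add_le_max : ∀ a b, ν (a + b) ≤ max (ν a) (ν b)
  norm_smul : ∀ (c : ℤ_[p]) (a : B), ν (c • a) = ‖c‖ * ν a
  mul_le : ∀ a b, ν (a * b) ≤ ν a * ν b
  norm_star : ∀ a, ν (star a) = ν a
  complete : ∀ a : ℕ → B, (∀ ε > 0, ∃ N, ∀ k ≥ N, ∀ l ≥ N, ν (a k - a l) < ε) →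
    ∃ b, Tendsto (fun k => ν (a k - b)) atTop (𝓝 0)

/-- The *-algebra `B` over `ℤ_p` with the norm `ν` is a p-adic operator algebra: it is a Banach
*-algebra, and for some set `X` (a discrete space) there is an isometric *-homomorphism from `B` to
the *-algebra `𝓑(c₀(X, ℤ_p))`. -/
structure IsPadicOperatorAlgebra (ν : B → ℝ) : Prop where
  banach : IsBanachStarAlgebra p B ν
  exists_rep : ∃ (X : Type u) (_ : TopologicalSpace X) (_ : DiscreteTopology X)
    (π : B →⋆ₙₐ[ℤ_[p]] AdjOp p X), ∀ b, opNorm (π b) = ν b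

end OperatorAlgebras

/-- The unit ball `{f ∈ A : ν f ≤ 1}` of the commutative algebra `A` is a `ℤ_p`-subalgebra of `A`
and, with the trivial involution `f* = f` and the norm `ν`, it is a p-adic operator algebra. -/
def UnitBallIsPadicOperatorAlgebra (p : ℕ) [Fact p.Prime] {A : Type u} [CommRing A]
    [Algebra ℤ_[p] A] (ν : A → ℝ) : Prop :=
  ∃ B : Subalgebra ℤ_[p] A, (∀ f, f ∈ B ↔ ν f ≤ 1) ∧
    letI : StarRing B := starRingOfComm
    IsPadicOperatorAlgebra p B fun b => ν b

/-! ### Norms on quotients, the maximum norm and the spectral norm -/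

section Norms

variable {R : Type u} [CommRing R]

/-- The quotient norm `‖a‖ = inf {ν F : F ∈ a}` on `R ⧸ J` of a norm `ν` on `R`. -/
def quotNorm (ν : R → ℝ) (J : Ideal R) (a : R ⧸ J) : ℝ :=
  sInf {r : ℝ | ∃ F : R, Ideal.Quotient.mk J F = a ∧ r = ν F}

/-- The norm `‖f + 𝔪‖` of the class of `f`, where `R ⧸ 𝔪` carries the quotient norm of `ν`. -/
def classNorm (ν : R → ℝ) (m : MaximalSpectrum R) (f : R) : ℝ :=
  quotNorm ν m.asIdeal (Ideal.Quotient.mk m.asIdeal f)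

/-- The norm `‖f‖ = max_𝔪 ‖f + 𝔪‖`. -/
def maxNorm (ν : R → ℝ) (f : R) : ℝ := ⨆ m : MaximalSpectrum R, classNorm ν m f

variable (p : ℕ) [Fact p.Prime] [Algebra ℚ_[p] R]

/-- The absolute value of the class of `f` in the field `R ⧸ 𝔪`, for the unique absolute value on
the algebraic extension `R ⧸ 𝔪` of `ℚ_p` that extends the one of `ℚ_p`. -/
def classAbs (m : MaximalSpectrum R) (f : R) : ℝ :=
  letI : m.asIdeal.IsMaximal := m.isMaximal
  letI : Field (R ⧸ m.asIdeal) := Ideal.Quotient.field m.asIdeal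
  spectralNorm ℚ_[p] (R ⧸ m.asIdeal) (Ideal.Quotient.mk m.asIdeal f)

/-- The spectral norm `|f| = sup_𝔪 |f + 𝔪|`. -/
def spectralSeminorm (f : R) : ℝ := ⨆ m : MaximalSpectrum R, classAbs p m f

end Norms

/-! ### Affinoid algebras -/

section Affinoid

variable (p : ℕ) [Fact p.Prime] (n : ℕ)

/-- The Tate algebra `ℚ_p⟨x₁, …, xₙ⟩`: the power series whose coefficients tend to `0`. -/
def TateAlgebra : Subalgebra ℚ_[p] (MvPowerSeries (Fin n) ℚ_[p]) where
  toSubsemiring := (MvPowerSeries.IsRestricted.subring (fun _ : Fin n => (1 : ℝ))).toSubsemiring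
  algebraMap_mem' c := MvPowerSeries.isRestricted_C _ c

variable {p n}

/-- The Gauss norm: the supremum of the absolute values of the coefficients. -/
def gaussNorm (F : TateAlgebra p n) : ℝ :=
  MvPowerSeries.gaussNorm (fun c : ℚ_[p] => ‖c‖) (fun _ => 1) F.1

/-- The affinoid algebra `A = ℚ_p⟨x₁, …, xₙ⟩ ⧸ I`. -/
abbrev AffinoidAlgebra (I : Ideal (TateAlgebra p n)) : Type := TateAlgebra p n ⧸ I

/-- The quotient norm on `A = ℚ_p⟨x₁, …, xₙ⟩ ⧸ I` of the Gauss norm. -/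
def residueNorm (I : Ideal (TateAlgebra p n)) : AffinoidAlgebra I → ℝ := quotNorm gaussNorm I

end Affinoid

end PadicOpAlg

end

/-! Both norms are detected by multiplication operators on finite free `ℤ_p`-algebras. Let S be the
image of `ℤ_p⟨x₁, …, xₙ⟩` in A, so that A = S[1/p]. For each maximal ideal 𝔪 take a finite
`ℤ_p`-subalgebra O_𝔪 of A/𝔪 containing the image of S: that image itself in (1), the integral
closure of `ℤ_p` in (2). Let B be the set of all f with f + 𝔪 ∈ O_𝔪 for every 𝔪. In both cases the
norm ν takes only the values 0 and powers of p, and ν(f) ≤ p^k means p^k f ∈ B (`IsLatticeNorm`). In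
(1) this discreteness is also why the maximum is attained; in (2) it is what the hypothesis on the
values provides.

Representation. B acts on O_𝔪 by multiplication, and f is divisible by p^k in O_𝔪 exactly when all
entries of its matrix are. So the block diagonal operator over all 𝔪 has norm ν(f). Its blocks need
not be symmetric, as the trivial involution demands. For p ≠ 2 there is a matrix e over `ℤ_p` with
e² = e and eᵀ = 1 - e, and T ↦ T ⊗ e + Tᵀ ⊗ eᵀ makes the matrices symmetric, is multiplicative on
commuting matrices and preserves divisibility of entries (`symmetrize_mul`, `dvd_of_dvd_symmetrize`,
`exists_rep_of_detected`).

Completeness. It suffices that p^C B ⊆ S ⊆ B for some C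
(`IsModel.exists_pow_mul_mem_of_forall_mem`), because S is p-adically complete. For b ∈ B, the
element g = pb has absolute value less than 1 at every point, so gY = 1 has no solution with Y
integral at any point. A Nullstellensatz for S⟨Y⟩ then puts a power of g in S
(`IsModel.exists_pow_mem`), and g is integral over S. Since A is reduced, the elements integral over
S are bounded (`IsModel.exists_pow_mul_mem`): this reduces to the finiteness of the integral
closures of the domains S/q (`IsTopFinite.finite_integralClosure`), which follows from Noether
normalization and the normality of `ℤ_p⟨x₁, …, x_d⟩`. These facts about p-adically complete rings
are lifted from their reductions modulo p by successive approximation. -/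

noncomputable section

namespace PadicOpAlg

universe u

/-! ### Rings that are complete for the `π`-adic topology -/

section Complete

/-- The module `M` is separated for the `π`-adic topology. -/
def IsSeparated {S : Type*} [CommRing S] (π : S) (M : Type*) [AddCommGroup M] [Module S M] : Prop :=
  ∀ x : M, (∀ k : ℕ, ∃ y : M, x = π ^ k • y) → x = 0

/-- The ring `S` is separated and complete for the `π`-adic topology. -/
structure IsPiComplete {S : Type*} [CommRing S] (π : S) : Prop where
  haus : ∀ x : S, (∀ k : ℕ, π ^ k ∣ x) → x = 0
  prec : ∀ g : ℕ → S, ∃ L, ∀ n, π ^ n ∣ L - ∑ i ∈ Finset.range n, π ^ i * g i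

variable {S : Type*} [CommRing S] {π : S}

/-- The inverse of 1 - πy is the geometric series in πy. -/
theorem IsPiComplete.exists_mul_eq_one (h : IsPiComplete π) (y : S) :
    ∃ z, (1 - π * y) * z = 1 := by
  obtain ⟨L, hL⟩ := h.prec fun i => y ^ i
  refine ⟨L, sub_eq_zero.1 (h.haus _ fun k => ?_)⟩
  have h1 : (1 - π * y) * L - 1
      = (1 - π * y) * (L - ∑ i ∈ Finset.range k, π ^ i * y ^ i) - π ^ k * y ^ k := by
    have := mul_neg_geom_sum (π * y) k
    simp only [mul_pow] at this
    rw [mul_sub, this]; ring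
  rw [h1]
  exact dvd_sub (Dvd.dvd.mul_left (hL k) _) (dvd_mul_right _ _)

theorem IsPiComplete.le_jacobson (h : IsPiComplete π) : Ideal.span {π} ≤ Ideal.jacobson ⊥ := by
  rw [Ideal.span_singleton_le_iff_mem, Ideal.mem_jacobson_bot]
  intro y
  obtain ⟨z, hz⟩ := h.exists_mul_eq_one (-y)
  exact IsUnit.of_mul_eq_one z (by linear_combination hz)

theorem span_pow_smul_top {M : Type*} [AddCommGroup M] [Module S M] (k : ℕ) (x : M) :
    x ∈ (Ideal.span {π} ^ k • ⊤ : Submodule S M) ↔ ∃ y, x = π ^ k • y := by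
  rw [Ideal.span_singleton_pow, Submodule.ideal_span_singleton_smul]
  constructor
  · rintro ⟨y, -, rfl⟩; exact ⟨y, rfl⟩
  · rintro ⟨y, rfl⟩; exact ⟨y, trivial, rfl⟩

/-- Krull's intersection theorem, applicable because completeness puts π in the Jacobson radical. -/
theorem isSeparated_of_isNoetherianRing [IsNoetherianRing S] (h : IsPiComplete π) (M : Type*)
    [AddCommGroup M] [Module S M] [Module.Finite S M] : IsSeparated π M := by
  intro x hx
  have := IsHausdorff.of_le_jacobson (M := M) (Ideal.span {π}) h.le_jacobson
  refine IsHausdorff.haus this x fun k => ?_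
  rw [SModEq.zero, span_pow_smul_top]
  exact hx k

/-- A separated module that is generated modulo `π` by finitely many elements is generated
by them. -/
theorem span_eq_top_of_complete (h : IsPiComplete π) {M : Type*} [AddCommGroup M] [Module S M]
    (hM : IsSeparated π M) {r : ℕ} (m : Fin r → M)
    (hm : ∀ x : M, ∃ (a : Fin r → S) (y : M), x = ∑ i, a i • m i + π • y) :
    Submodule.span S (Set.range m) = ⊤ := by
  rw [eq_top_iff]
  rintro x -
  choose a y hay using hm
  let X : ℕ → M := fun k => y^[k] x
  have hX : ∀ k, X k = ∑ i, a (X k) i • m i + π • X (k + 1) := by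
    intro k
    have : X (k + 1) = y (X k) := Function.iterate_succ_apply' y k x
    rw [this]; exact hay _
  -- Iterating the approximation: `X n` is the remainder after n rounds, and the coefficients
  -- collected so far are partial sums of π-adically convergent series.
  have hsum : ∀ n, x = ∑ i, (∑ k ∈ Finset.range n, π ^ k * a (X k) i) • m i + π ^ n • X n := by
    intro n
    induction n with
    | zero => simp [X]
    | succ n ih =>
      conv_lhs => rw [ih, hX n]
      simp only [Finset.sum_range_succ, add_smul, Finset.sum_add_distrib, smul_add,
        Finset.smul_sum, mul_smul, pow_succ, add_assoc]
  choose b hb using fun i => h.prec fun k => a (X k) i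
  have : x = ∑ i, b i • m i := by
    rw [← sub_eq_zero]
    refine hM _ fun n => ?_
    choose c hc using fun i => hb i n
    refine ⟨X n - ∑ i, c i • m i, ?_⟩
    have h2 : ∑ i, b i • m i
        = ∑ i, (∑ k ∈ Finset.range n, π ^ k * a (X k) i) • m i + π ^ n • ∑ i, c i • m i := by
      rw [Finset.smul_sum, ← Finset.sum_add_distrib]
      refine Finset.sum_congr rfl fun i _ => ?_
      rw [smul_smul, ← hc, ← add_smul]; congr 1; ring
    rw [h2]
    conv_lhs => rw [hsum n]
    rw [smul_sub]; abel
  rw [this]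
  exact Submodule.sum_mem _ fun i _ => Submodule.smul_mem _ _ (Submodule.subset_span ⟨i, rfl⟩)

/-- By Cohen's theorem only a prime P needs finite generation. Lifts of generators of its image
modulo π generate P up to multiples of π. If π ∈ P, adjoin π; otherwise primality makes the error
term πy lie in πP, and successive approximation applies to P. -/
theorem IsPiComplete.isNoetherianRing (h : IsPiComplete π)
    [IsNoetherianRing (S ⧸ Ideal.span {π})] : IsNoetherianRing S := by
  refine IsNoetherianRing.of_prime fun P hP => ?_
  obtain ⟨s, hs⟩ : (P.map (Ideal.Quotient.mk (Ideal.span {π}))).FG := IsNoetherian.noetherian _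
  have hmem : ∀ y ∈ s, ∃ x ∈ P, Ideal.Quotient.mk (Ideal.span {π}) x = y := by
    intro y hy
    have : y ∈ P.map (Ideal.Quotient.mk (Ideal.span {π})) := hs ▸ Submodule.subset_span hy
    rwa [Ideal.mem_map_iff_of_surjective _ Ideal.Quotient.mk_surjective] at this
  choose! x hxP hx using hmem
  let e := s.equivFin
  have hgen : ∀ z ∈ P, ∃ (c : Fin s.card → S) (y : S), z = ∑ i, c i * x (e.symm i) + π * y := by
    intro z hzP
    have hz : Ideal.Quotient.mk (Ideal.span {π}) z ∈ Ideal.span (s : Set _) :=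
      hs ▸ Ideal.mem_map_of_mem _ hzP
    obtain ⟨c, hc⟩ := Submodule.mem_span_finset.1 hz
    choose c' hc' using fun y => Ideal.Quotient.mk_surjective (c y)
    have h1 : z - ∑ i, c' (e.symm i) * x (e.symm i) ∈ Ideal.span {π} := by
      rw [← Ideal.Quotient.eq_zero_iff_mem, map_sub, sub_eq_zero, ← hc.2, map_sum,
        ← Finset.sum_coe_sort]
      refine (Equiv.sum_comp e.symm (fun y : s => c y * (y : S ⧸ Ideal.span {π}))).symm.trans ?_
      refine Finset.sum_congr rfl fun i _ => ?_
      rw [map_mul, hc', hx _ (e.symm i).2]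
    obtain ⟨y, hy⟩ := Ideal.mem_span_singleton'.1 h1
    exact ⟨fun i => c' (e.symm i), y, by rw [mul_comm π, hy]; ring⟩
  by_cases hπ : π ∈ P
  · classical
    refine ⟨insert π (s.image x), le_antisymm ?_ fun z hz => ?_⟩
    · rw [Submodule.span_le]
      intro z hz
      simp only [Finset.coe_insert, Finset.coe_image, Set.mem_insert_iff, Set.mem_image,
        Finset.mem_coe] at hz
      rcases hz with rfl | ⟨y, hy, rfl⟩
      exacts [hπ, hxP y hy]
    · obtain ⟨c, y, rfl⟩ := hgen z hz
      refine Submodule.add_mem _ (Submodule.sum_mem _ fun i _ => ?_) ?_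
      · refine Submodule.smul_mem _ _ (Submodule.subset_span ?_)
        simp only [Finset.coe_insert, Finset.coe_image]
        exact Or.inr ⟨_, (e.symm i).2, rfl⟩
      · rw [mul_comm]
        exact Submodule.smul_mem _ _ (Submodule.subset_span (by simp))
  · let m : Fin s.card → P := fun i => ⟨x (e.symm i), hxP _ (e.symm i).2⟩
    have hsep : IsSeparated π P := by
      intro z hz
      refine Subtype.ext (h.haus _ fun k => ?_)
      obtain ⟨y, rfl⟩ := hz k
      exact ⟨y, rfl⟩
    have key : Submodule.span S (Set.range m) = ⊤ := by
      refine span_eq_top_of_complete h hsep m fun z => ?_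
      obtain ⟨c, y, hy⟩ := hgen z z.2
      have hyP : y ∈ P := by
        have : π * y ∈ P := by
          rw [← sub_eq_iff_eq_add'.2 hy]
          exact P.sub_mem z.2 (P.sum_mem fun i _ => P.mul_mem_left _ (hxP _ (e.symm i).2))
        exact (hP.mem_or_mem this).resolve_left hπ
      refine ⟨c, ⟨y, hyP⟩, Subtype.ext ?_⟩
      simpa [m] using hy
    have : Module.Finite S P := ⟨Submodule.fg_def.2 ⟨_, Set.finite_range m, key⟩⟩
    exact Module.Finite.iff_fg.1 this

/-- Limits lift along f; separatedness of the quotient is the part that needs S Noetherian. -/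
theorem IsPiComplete.of_surjective [IsNoetherianRing S] (h : IsPiComplete π) {T : Type*}
    [CommRing T] (f : S →+* T) (hf : Function.Surjective f) : IsPiComplete (f π) where
  haus x hx := by
    let := f.toAlgebra
    have : Module.Finite S T := Module.Finite.of_surjective (Algebra.linearMap S T) hf
    refine isSeparated_of_isNoetherianRing h T x fun k => ?_
    obtain ⟨y, hy⟩ := hx k
    exact ⟨y, by rw [hy, Algebra.smul_def, map_pow]; rfl⟩
  prec g := by
    choose g' hg' using fun i => hf (g i)
    obtain ⟨L, hL⟩ := h.prec g'
    refine ⟨f L, fun n => ?_⟩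
    have := map_dvd f (hL n)
    simpa [hg'] using this

end Complete

/-! ### Power series whose coefficients tend to zero in the `π`-adic topology -/

section Restricted

variable {S : Type*} [CommRing S] (π : S) (σ : Type*)

/-- The power series over `S` whose coefficients tend to zero in the `π`-adic topology. -/
def RestrictedSeries : Subalgebra S (MvPowerSeries σ S) where
  carrier := {F | ∀ k : ℕ, {m | ¬ π ^ k ∣ MvPowerSeries.coeff m F}.Finite}
  mul_mem' := by
    classical
    intro F G hF hG k
    refine ((hF k).image2 (· + ·) (hG k)).subset fun m hm => ?_
    by_contra hcon
    refine hm ?_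
    rw [MvPowerSeries.coeff_mul]
    refine Finset.dvd_sum fun q hq => ?_
    by_contra hq'
    refine hcon ⟨q.1, fun h => hq' (h.mul_right _), q.2, fun h => hq' (h.mul_left _), ?_⟩
    exact Finset.HasAntidiagonal.mem_antidiagonal.1 hq
  add_mem' := by
    intro F G hF hG k
    refine ((hF k).union (hG k)).subset fun m hm => ?_
    by_contra hcon
    simp only [Set.mem_union, Set.mem_ofPred_eq, not_or, not_not] at hcon
    exact hm (by rw [map_add]; exact dvd_add hcon.1 hcon.2)
  algebraMap_mem' := by
    classical
    intro c k
    refine (Set.finite_singleton 0).subset fun m hm => ?_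
    by_contra hcon
    refine hm ?_
    rw [MvPowerSeries.algebraMap_apply, MvPowerSeries.coeff_C, if_neg (by simpa using hcon)]
    exact dvd_zero _

variable {π σ}

namespace RestrictedSeries

/-- The coefficient of the monomial `m`. -/
def coeff (m : σ →₀ ℕ) : RestrictedSeries π σ →ₗ[S] S :=
  (MvPowerSeries.coeff m).comp (RestrictedSeries π σ).val.toLinearMap

theorem ext {F G : RestrictedSeries π σ} (h : ∀ m, coeff m F = coeff m G) : F = G :=
  Subtype.ext (MvPowerSeries.ext h)

theorem coeff_algebraMap_mul (m : σ →₀ ℕ) (c : S) (F : RestrictedSeries π σ) :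
    coeff m (algebraMap S _ c * F) = c * coeff m F := by
  rw [← Algebra.smul_def, map_smul, smul_eq_mul]

/-- Since π is a nonzerodivisor, dividing the coefficients by π^k merely shifts their π-adic orders,
so the quotient series is again restricted. -/
theorem pow_dvd_iff (hπ : π ∈ nonZeroDivisors S) {k : ℕ} {F : RestrictedSeries π σ} :
    algebraMap S (RestrictedSeries π σ) π ^ k ∣ F ↔ ∀ m, π ^ k ∣ coeff m F := by
  constructor
  · rintro ⟨G, rfl⟩ m
    rw [← map_pow, coeff_algebraMap_mul]
    exact dvd_mul_right _ _
  · intro h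
    choose c hc using h
    have hcr : (show MvPowerSeries σ S from c) ∈ RestrictedSeries π σ := by
      intro j
      refine (F.2 (k + j)).subset fun m hm hdvd => hm ?_
      have h1 : MvPowerSeries.coeff m F.1 = π ^ k * c m := hc m
      rw [h1, pow_add] at hdvd
      obtain ⟨d, hd⟩ := hdvd
      refine ⟨d, (mul_cancel_left_mem_nonZeroDivisors (pow_mem hπ k)).1 ?_⟩
      rw [← mul_assoc, ← hd]; rfl
    refine ⟨⟨_, hcr⟩, ext fun m => ?_⟩
    rw [← map_pow, coeff_algebraMap_mul, hc]; rfl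

theorem mem_nonZeroDivisors (hπ : π ∈ nonZeroDivisors S) :
    algebraMap S (RestrictedSeries π σ) π ∈ nonZeroDivisors (RestrictedSeries π σ) := by
  rw [mem_nonZeroDivisors_iff_right]
  intro F hF
  refine ext fun m => ?_
  have := congrArg (coeff m) hF
  rw [mul_comm, coeff_algebraMap_mul, map_zero] at this
  rw [map_zero]
  exact (mem_nonZeroDivisors_iff.1 hπ).1 _ this

/-- Limits are taken coefficientwise. The limit is restricted because modulo π^k it agrees with a
finite partial sum. -/
theorem isPiComplete (h : IsPiComplete π) (hπ : π ∈ nonZeroDivisors S) :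
    IsPiComplete (algebraMap S (RestrictedSeries π σ) π) where
  haus F hF := ext fun m => h.haus _ fun k => (pow_dvd_iff hπ).1 (hF k) m
  prec g := by
    choose L hL using fun m => h.prec fun i => coeff m (g i)
    have hsum : ∀ n m, coeff m (∑ i ∈ Finset.range n, algebraMap S _ π ^ i * g i)
        = ∑ i ∈ Finset.range n, π ^ i * coeff m (g i) := by
      intro n m
      rw [map_sum]
      exact Finset.sum_congr rfl fun i _ => by rw [← map_pow, coeff_algebraMap_mul]
    have hLr : (show MvPowerSeries σ S from L) ∈ RestrictedSeries π σ := by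
      intro k
      refine ((∑ i ∈ Finset.range k, algebraMap S _ π ^ i * g i).2 k).subset fun m hm hdvd => hm ?_
      have := dvd_add (hL m k) ((hsum k m) ▸ hdvd :
        π ^ k ∣ ∑ i ∈ Finset.range k, π ^ i * coeff m (g i))
      rwa [sub_add_cancel] at this
    refine ⟨⟨_, hLr⟩, fun n => (pow_dvd_iff hπ).2 fun m => ?_⟩
    rw [map_sub, hsum]
    exact hL m n

/-- Polynomials as restricted power series. -/
def ofPolynomial : MvPolynomial σ S →ₐ[S] RestrictedSeries π σ :=
  (MvPolynomial.coeToMvPowerSeries.algHom (σ := σ) (R := S) S).codRestrict _ fun P k => by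
    refine P.support.finite_toSet.subset fun m hm => ?_
    by_contra hcon
    refine hm ?_
    rw [MvPolynomial.coeToMvPowerSeries.algHom_apply]
    have : P.coeff m = 0 := by simpa using hcon
    simp [this]

theorem coeff_ofPolynomial (P : MvPolynomial σ S) (m : σ →₀ ℕ) :
    coeff m (ofPolynomial (π := π) P) = P.coeff m := by
  change MvPowerSeries.coeff m (MvPolynomial.coeToMvPowerSeries.algHom S P) = _
  rw [MvPolynomial.coeToMvPowerSeries.algHom_apply]
  simp

theorem exists_polynomial (hπ : π ∈ nonZeroDivisors S) (F : RestrictedSeries π σ) (k : ℕ) :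
    ∃ P : MvPolynomial σ S, algebraMap S _ π ^ k ∣ F - ofPolynomial P := by
  classical
  let P : MvPolynomial σ S := ∑ m ∈ (F.2 k).toFinset, MvPolynomial.monomial m (coeff m F)
  refine ⟨P, (pow_dvd_iff hπ).2 fun m => ?_⟩
  have hP : P.coeff m = if m ∈ (F.2 k).toFinset then coeff m F else 0 := by
    simp [P, MvPolynomial.coeff_sum, MvPolynomial.coeff_monomial]
  rw [map_sub, coeff_ofPolynomial, hP]
  split_ifs with hm
  · simp
  · rw [sub_zero]
    have : ¬ ¬ π ^ k ∣ MvPowerSeries.coeff m F.1 := by simpa using hm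
    exact not_not.1 this

theorem pow_dvd_ofPolynomial_iff (hπ : π ∈ nonZeroDivisors S) (P : MvPolynomial σ S) (k : ℕ) :
    algebraMap S _ π ^ k ∣ ofPolynomial (π := π) P ↔ MvPolynomial.C (π ^ k) ∣ P := by
  rw [pow_dvd_iff hπ, MvPolynomial.C_dvd_iff_dvd_coeff]
  simp only [coeff_ofPolynomial]

/-- The quotient modulo `π` is a quotient of the polynomial ring. -/
theorem mk_ofPolynomial_surjective (hπ : π ∈ nonZeroDivisors S) :
    Function.Surjective
      ((Ideal.Quotient.mkₐ S (Ideal.span {algebraMap S (RestrictedSeries π σ) π})).comp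
        (ofPolynomial (π := π) (σ := σ))) := by
  intro x
  obtain ⟨F, rfl⟩ := Ideal.Quotient.mk_surjective x
  obtain ⟨P, hP⟩ := exists_polynomial hπ F 1
  refine ⟨P, ?_⟩
  rw [AlgHom.comp_apply, Ideal.Quotient.mkₐ_eq_mk, eq_comm, Ideal.Quotient.eq,
    Ideal.mem_span_singleton]
  simpa using hP

end RestrictedSeries

end Restricted

/-! ### Algebras topologically of finite type over `ℤ_p` -/

section TopFinite

variable {p : ℕ} [Fact p.Prime]

theorem IsPiComplete.eq_of_dvd {S : Type*} [CommRing S] {π : S} (h : IsPiComplete π) {x y : S}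
    (hxy : ∀ k : ℕ, π ^ k ∣ x - y) : x = y :=
  sub_eq_zero.1 (h.haus _ hxy)

theorem natCast_mem_nonZeroDivisors_padicInt : (p : ℤ_[p]) ∈ nonZeroDivisors ℤ_[p] :=
  mem_nonZeroDivisors_of_ne_zero (PadicInt.prime_p).ne_zero

theorem isPiComplete_padicInt : IsPiComplete (p : ℤ_[p]) where
  haus x hx := by
    by_contra h0
    have := (PadicInt.norm_le_pow_iff_le_valuation x h0 (x.valuation + 1)).1
      ((PadicInt.norm_le_pow_iff_mem_span_pow x _).2 (Ideal.mem_span_singleton.2 (hx _)))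
    omega
  prec g := by
    have h : IsAdicComplete (Ideal.span {(p : ℤ_[p])}) ℤ_[p] := by
      rw [← PadicInt.maximalIdeal_eq_span_p]; infer_instance
    obtain ⟨L, hL⟩ := h.toIsPrecomplete.prec'
      (fun n => ∑ i ∈ Finset.range n, (p : ℤ_[p]) ^ i * g i) (fun {m n} hmn => by
        symm
        rw [SModEq.sub_mem, span_pow_smul_top, ← Finset.sum_range_add_sum_Ico _ hmn,
          add_sub_cancel_left]
        have : (p : ℤ_[p]) ^ m ∣ ∑ i ∈ Finset.Ico m n, (p : ℤ_[p]) ^ i * g i :=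
          Finset.dvd_sum fun i hi => (pow_dvd_pow _ (Finset.mem_Ico.1 hi).1).mul_right _
        exact this)
    refine ⟨L, fun n => ?_⟩
    have := (hL n).symm
    rw [SModEq.sub_mem, span_pow_smul_top] at this
    exact this

variable (p) in
/-- The `ℤ_p`-algebra `S` is `p`-adically complete and of finite type modulo `p`. -/
structure IsTopFinite (S : Type*) [CommRing S] [Algebra ℤ_[p] S] : Prop where
  complete : IsPiComplete (p : S)
  finiteType : Algebra.FiniteType ℤ_[p] (S ⧸ Ideal.span {(p : S)})

theorem isTopFinite_padicInt : IsTopFinite p ℤ_[p] where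
  complete := isPiComplete_padicInt
  finiteType := inferInstance

variable {S : Type*} [CommRing S] [Algebra ℤ_[p] S]

theorem IsTopFinite.isNoetherianRing (h : IsTopFinite p S) : IsNoetherianRing S := by
  have := h.finiteType
  have := Algebra.FiniteType.isNoetherianRing ℤ_[p] (S ⧸ Ideal.span {(p : S)})
  exact h.complete.isNoetherianRing

theorem IsTopFinite.of_surjective (h : IsTopFinite p S) {T : Type*} [CommRing T]
    [Algebra ℤ_[p] T] (f : S →ₐ[ℤ_[p]] T) (hf : Function.Surjective f) : IsTopFinite p T where
  complete := by
    have := h.isNoetherianRing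
    simpa using h.complete.of_surjective (f : S →+* T) hf
  finiteType := by
    have := h.finiteType
    have hle : Ideal.span {(p : S)} ≤ (Ideal.span {(p : T)}).comap f := by
      rw [Ideal.span_singleton_le_iff_mem, Ideal.mem_comap, map_natCast]
      exact Ideal.mem_span_singleton_self _
    refine Algebra.FiniteType.of_surjective (Ideal.quotientMapₐ _ f hle) ?_
    intro x
    obtain ⟨t, rfl⟩ := Ideal.Quotient.mk_surjective x
    obtain ⟨s, rfl⟩ := hf t
    exact ⟨Ideal.Quotient.mk _ s, rfl⟩

/-- R is really an algebra over S/I, so finite generation can be composed through S/I even when S is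
not of finite type over k. -/
theorem _root_.Algebra.FiniteType.of_vanishing {k R : Type*} [CommRing k] [Algebra k S] [CommRing R]
    [Algebra S R] [Algebra k R] [IsScalarTower k S R] {I : Ideal S}
    (hI : Algebra.FiniteType k (S ⧸ I)) (hR : Algebra.FiniteType S R)
    (h : ∀ a ∈ I, algebraMap S R a = 0) : Algebra.FiniteType k R := by
  let := (Ideal.Quotient.lift I (algebraMap S R) h).toAlgebra
  have : IsScalarTower S (S ⧸ I) R := IsScalarTower.of_algebraMap_eq fun x => rfl
  have : IsScalarTower k (S ⧸ I) R := IsScalarTower.of_algebraMap_eq fun x => by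
    rw [IsScalarTower.algebraMap_apply k S R]; rfl
  have := Algebra.FiniteType.of_restrictScalars_finiteType S (S ⧸ I) R
  exact Algebra.FiniteType.trans hI this

theorem IsTopFinite.restrictedSeries (h : IsTopFinite p S) (hp : (p : S) ∈ nonZeroDivisors S)
    (σ : Type*) [Finite σ] : IsTopFinite p (RestrictedSeries (p : S) σ) where
  complete := by simpa using RestrictedSeries.isPiComplete (σ := σ) h.complete hp
  finiteType := by
    have hft := h.finiteType
    let R : Type _ := RestrictedSeries (p : S) σ
    let J : Ideal R := Ideal.span {(p : R)}
    have hsurj : Function.Surjective ((Ideal.Quotient.mkₐ S J).comp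
        (RestrictedSeries.ofPolynomial (π := (p : S)) (σ := σ))) := by
      have := RestrictedSeries.mk_ofPolynomial_surjective (σ := σ) hp
      rwa [map_natCast] at this
    have h1 : Algebra.FiniteType S (R ⧸ J) := Algebra.FiniteType.of_surjective _ hsurj
    refine hft.of_vanishing h1 fun a ha => ?_
    obtain ⟨b, rfl⟩ := Ideal.mem_span_singleton'.1 ha
    have : ((p : R) : R ⧸ J) = 0 :=
      Ideal.Quotient.eq_zero_iff_mem.2 (Ideal.mem_span_singleton_self _)
    rw [map_natCast] at this
    rw [map_mul, map_natCast, this, mul_zero]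

/-- The evaluation of restricted power series over `ℤ_p` at a point of a complete algebra. -/
theorem RestrictedSeries.exists_eval (h : IsPiComplete (p : S)) {σ : Type*} (y : σ → S) :
    ∃ f : RestrictedSeries (p : ℤ_[p]) σ →ₐ[ℤ_[p]] S,
      ∀ P, f (RestrictedSeries.ofPolynomial P) = MvPolynomial.aeval y P := by
  let R : Type _ := RestrictedSeries (p : ℤ_[p]) σ
  have hp := natCast_mem_nonZeroDivisors_padicInt (p := p)
  have happrox : ∀ (F : R) k, ∃ P, (p : R) ^ k ∣ F - ofPolynomial P := fun F k => by
    simpa using RestrictedSeries.exists_polynomial hp F k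
  have hev : ∀ (P : MvPolynomial σ ℤ_[p]) (k : ℕ),
      (p : R) ^ k ∣ ofPolynomial P → (p : S) ^ k ∣ MvPolynomial.aeval y P := by
    intro P k hP
    have h1 := RestrictedSeries.pow_dvd_ofPolynomial_iff hp P k
    rw [map_natCast] at h1
    have := map_dvd (MvPolynomial.aeval (R := ℤ_[p]) y) (h1.1 hP)
    simpa using this
  -- The value is required to be compatible with every polynomial approximation, not just with the
  -- chosen sequence. This makes it unique, and additivity and multiplicativity then follow by
  -- approximating both arguments.
  have hex : ∀ F : R, ∃ L : S, ∀ k P, (p : R) ^ k ∣ F - ofPolynomial P →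
      (p : S) ^ k ∣ L - MvPolynomial.aeval y P := by
    intro F
    choose P hP using happrox F
    have hstep : ∀ k, (p : S) ^ k ∣ MvPolynomial.aeval y (P (k + 1)) - MvPolynomial.aeval y (P k) := by
      intro k
      rw [← map_sub]
      refine hev _ _ ?_
      have := dvd_sub (hP k) ((pow_dvd_pow _ (Nat.le_succ k)).trans (hP (k + 1)))
      rw [map_sub]
      convert! this using 1
      ring
    choose g hg using hstep
    have hs : ∀ n, ∑ i ∈ Finset.range n, (p : S) ^ i * g i
        = MvPolynomial.aeval y (P n) - MvPolynomial.aeval y (P 0) := by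
      intro n
      simp only [← hg]
      exact Finset.sum_range_sub (fun n => MvPolynomial.aeval y (P n)) n
    obtain ⟨L, hL⟩ := h.prec g
    refine ⟨L + MvPolynomial.aeval y (P 0), fun k Q hQ => ?_⟩
    have h1 := hL k
    rw [hs] at h1
    have h2 : (p : S) ^ k ∣ MvPolynomial.aeval y (P k) - MvPolynomial.aeval y Q := by
      rw [← map_sub]
      refine hev _ _ ?_
      have := dvd_sub hQ (hP k)
      rw [map_sub]
      convert! this using 1
      ring
    have := dvd_add h1 h2
    convert! this using 1
    ring
  choose L hL using hex
  have huniq : ∀ F x, (∀ k P, (p : R) ^ k ∣ F - ofPolynomial P →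
      (p : S) ^ k ∣ x - MvPolynomial.aeval y P) → L F = x := by
    intro F x hx
    refine h.eq_of_dvd fun k => ?_
    obtain ⟨P, hP⟩ := happrox F k
    have := dvd_sub (hL F k P hP) (hx k P hP)
    rwa [sub_sub_sub_cancel_right] at this
  have hpoly : ∀ P, L (ofPolynomial P) = MvPolynomial.aeval y P := fun P => huniq _ _ fun k Q hQ => by
    rw [← map_sub]; exact hev _ _ (by rwa [map_sub])
  have hadd : ∀ F G, L (F + G) = L F + L G := by
    intro F G
    refine h.eq_of_dvd fun k => ?_
    obtain ⟨P, hP⟩ := happrox F k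
    obtain ⟨Q, hQ⟩ := happrox G k
    have h1 := hL (F + G) k (P + Q) (by
      rw [map_add]; convert! dvd_add hP hQ using 1; ring)
    rw [map_add] at h1
    have := dvd_sub h1 (dvd_add (hL F k P hP) (hL G k Q hQ))
    convert! this using 1; ring
  have hmul : ∀ F G, L (F * G) = L F * L G := by
    intro F G
    refine h.eq_of_dvd fun k => ?_
    obtain ⟨P, hP⟩ := happrox F k
    obtain ⟨Q, hQ⟩ := happrox G k
    have h1 := hL (F * G) k (P * Q) (by
      rw [map_mul]
      convert! dvd_add (hP.mul_right G) (hQ.mul_left (ofPolynomial P)) using 1; ring)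
    rw [map_mul] at h1
    have := dvd_sub h1 (dvd_add ((hL F k P hP).mul_right (L G))
      ((hL G k Q hQ).mul_left (MvPolynomial.aeval y P)))
    convert! this using 1; ring
  have halg : ∀ c : ℤ_[p], L (algebraMap ℤ_[p] R c) = algebraMap ℤ_[p] S c := by
    intro c
    have := hpoly (algebraMap _ _ c)
    rwa [AlgHom.commutes, AlgHom.commutes] at this
  exact ⟨{ toFun := L
           map_one' := by simpa using halg 1
           map_zero' := by simpa using halg 0
           map_add' := hadd
           map_mul' := hmul
           commutes' := halg }, hpoly⟩

end TopFinite

/-! ### Normality of complete rings with normal reduction -/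

section Normal

variable {R : Type*} [CommRing R] {π : R}

theorem IsPiComplete.exists_eq_pow_mul (h : IsPiComplete π) {x : R} (hx : x ≠ 0) :
    ∃ (k : ℕ) (y : R), x = π ^ k * y ∧ ¬ π ∣ y := by
  have hf : FiniteMultiplicity π x := by
    by_contra hcon
    refine hx (h.haus x fun k => ?_)
    by_contra hk
    exact hcon ⟨k, fun h' => hk ((pow_dvd_pow _ (Nat.le_succ k)).trans h')⟩
  obtain ⟨y, hy, hy'⟩ := hf.exists_eq_pow_mul_and_not_dvd
  exact ⟨_, y, hy, hy'⟩

variable {D : Type*} [CommRing D] [IsDomain D] (red : R →+* D)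

/-- Stripping powers of π from two nonzero factors leaves elements with nonzero images in the domain
D. -/
theorem IsPiComplete.isDomain (h : IsPiComplete π) (hπ : π ∈ nonZeroDivisors R)
    (hker : ∀ x, red x = 0 ↔ π ∣ x) : IsDomain R := by
  have : Nontrivial R := red.domain_nontrivial
  have : NoZeroDivisors R := ⟨fun {x y} hxy => by
    by_contra! hcon
    obtain ⟨k, x', rfl, hx⟩ := h.exists_eq_pow_mul hcon.1
    obtain ⟨l, y', rfl, hy⟩ := h.exists_eq_pow_mul hcon.2
    have h1 : π ^ (k + l) * (x' * y') = 0 := by rw [← hxy]; ring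
    have h2 : x' * y' = 0 := (mem_nonZeroDivisors_iff.1 (pow_mem hπ (k + l))).1 _ h1
    have h3 : red x' * red y' = 0 := by rw [← map_mul, h2, map_zero]
    rcases mul_eq_zero.1 h3 with h4 | h4
    exacts [hx ((hker _).1 h4), hy ((hker _).1 h4)]⟩
  exact NoZeroDivisors.to_isDomain R

/-- The hypothesis says that c(a/b)^n ∈ D for all n, that is, a/b is almost integral; over a
Noetherian ring this implies integral. -/
theorem dvd_of_pow_dvd_mul_pow [IsNoetherianRing D] [IsIntegrallyClosed D]
    {a b c : D} (hb : b ≠ 0) (hc : c ≠ 0) (h : ∀ n, b ^ n ∣ c * a ^ n) : b ∣ a := by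
  let K := FractionRing D
  have hbK : algebraMap D K b ≠ 0 := by simpa using hb
  have hai : IsAlmostIntegral D (algebraMap D K a / algebraMap D K b) := by
    refine ⟨c, mem_nonZeroDivisors_of_ne_zero hc, fun n => ?_⟩
    obtain ⟨e, he⟩ := h n
    refine ⟨e, ?_⟩
    rw [Algebra.smul_def, div_pow, mul_div_assoc', eq_div_iff (pow_ne_zero _ hbK), ← map_pow,
      ← map_pow, ← map_mul, ← map_mul, he, mul_comm]
  obtain ⟨q, hq⟩ := IsIntegrallyClosed.isIntegral_iff.1 hai.isIntegral
  refine ⟨q, IsFractionRing.injective D K ?_⟩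
  rw [map_mul, hq, mul_div_cancel₀ _ hbK]

/-- An integral fraction a/b is almost integral, a condition expressible by divisibilities b^n ∣ c
a^n, which pass to the reduction. There b divides a by normality of D, so a is a multiple of b up to
πa', and a' satisfies the same divisibilities. Iterating gives a ∈ bR + π^k R for all k, and R/b is
separated. -/
theorem IsPiComplete.isIntegrallyClosed [IsDomain R] [IsNoetherianRing R] [IsNoetherianRing D]
    [IsIntegrallyClosed D] (h : IsPiComplete π) (hπ : π ≠ 0)
    (hred : Function.Surjective red) (hker : ∀ x, red x = 0 ↔ π ∣ x) : IsIntegrallyClosed R := by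
  have hprime : Prime π := by
    refine ⟨hπ, fun hu => ?_, fun a b hab => ?_⟩
    · have h1 : red 1 = 0 := (hker 1).2 hu.dvd
      exact one_ne_zero ((map_one red).symm.trans h1)
    · rw [← hker, map_mul, mul_eq_zero, hker, hker] at hab
      exact hab
  have hpow : ∀ {b x : R} {n m : ℕ}, ¬ π ∣ b → b ^ n ∣ π ^ m * x → b ^ n ∣ x := by
    rintro b x n m hb ⟨y, hy⟩
    obtain ⟨z, rfl⟩ := hprime.pow_dvd_of_dvd_mul_left m (fun hd => hb (hprime.dvd_of_dvd_pow hd))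
      (Dvd.intro _ hy)
    refine ⟨z, mul_left_cancel₀ (pow_ne_zero m hπ) ?_⟩
    rw [hy]; ring
  have hstep : ∀ {a b c : R}, ¬ π ∣ b → ¬ π ∣ c → (∀ n, b ^ n ∣ c * a ^ n) →
      ∃ q a', a = b * q + π * a' ∧ ∀ n, b ^ n ∣ c * a' ^ n := by
    intro a b c hb hc hab
    obtain ⟨q', hq'⟩ : red b ∣ red a :=
      dvd_of_pow_dvd_mul_pow (c := red c) (fun h0 => hb ((hker _).1 h0))
        (fun h0 => hc ((hker _).1 h0)) fun n => by simpa using map_dvd red (hab n)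
    obtain ⟨q, rfl⟩ := hred q'
    obtain ⟨a', ha'⟩ : π ∣ a - b * q := by rw [← hker, map_sub, map_mul, hq', sub_self]
    refine ⟨q, a', by rw [← ha']; ring, fun n => ?_⟩
    refine hpow (m := n) hb ?_
    -- Each term of the expansion of c(a - bq)^n is divisible by b^n, since b^i ∣ c a^i; the factor
    -- π^n is then cancelled by `hpow`.
    have h1 : π ^ n * (c * a' ^ n) = c * (a + -(b * q)) ^ n := by
      rw [← sub_eq_add_neg, ha']; ring
    rw [h1, add_pow, Finset.mul_sum]
    refine Finset.dvd_sum fun i hi => ?_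
    obtain ⟨e, he⟩ := hab i
    refine ⟨e * (-q) ^ (n - i) * n.choose i, ?_⟩
    have hin : i + (n - i) = n := by
      have := Finset.mem_range.1 hi; omega
    have h2 : b ^ n = b ^ i * b ^ (n - i) := by rw [← pow_add, hin]
    calc c * (a ^ i * (-(b * q)) ^ (n - i) * (n.choose i : R))
        = (c * a ^ i) * (b ^ (n - i) * (-q) ^ (n - i)) * (n.choose i : R) := by
          rw [← mul_pow]; ring_nf
      _ = _ := by rw [he, h2]; ring
  have hcore : ∀ {a b c : R}, ¬ π ∣ b → ¬ π ∣ c → (∀ n, b ^ n ∣ c * a ^ n) → b ∣ a := by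
    intro a b c hb hc hab
    have happ : ∀ (k : ℕ) (a : R), (∀ n, b ^ n ∣ c * a ^ n) → ∃ q w, a = b * q + π ^ k * w := by
      intro k
      induction k with
      | zero => exact fun a _ => ⟨0, a, by simp⟩
      | succ k ih =>
        intro a ha
        obtain ⟨q, a', rfl, ha'⟩ := hstep hb hc ha
        obtain ⟨q', w, rfl⟩ := ih a' ha'
        exact ⟨q + π * q', w, by ring⟩
    rw [← Ideal.mem_span_singleton, ← Ideal.Quotient.eq_zero_iff_mem]
    refine isSeparated_of_isNoetherianRing h (R ⧸ Ideal.span {b}) _ fun k => ?_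
    obtain ⟨q, w, hqw⟩ := happ k a hab
    refine ⟨Ideal.Quotient.mk _ w, ?_⟩
    rw [hqw, map_add, map_mul, Ideal.Quotient.eq_zero_iff_mem.2 (Ideal.mem_span_singleton_self b),
      zero_mul, zero_add]
    rfl
  -- Induction on the power of π in b. If π ∣ b but π ∤ a, then π^n ∣ b^n ∣ c a^n would force π^n ∣
  -- c for every n, so c = 0; hence π can be cancelled from a and b.
  have hgen : ∀ {a b c : R}, b ≠ 0 → c ≠ 0 → (∀ n, b ^ n ∣ c * a ^ n) → b ∣ a := by
    intro a b c hb hc hab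
    obtain ⟨t, c, rfl, hc'⟩ := h.exists_eq_pow_mul hc
    obtain ⟨s, b, rfl, hb'⟩ := h.exists_eq_pow_mul hb
    induction s generalizing a with
    | zero =>
      simp only [pow_zero, one_mul] at hab ⊢
      exact hcore hb' hc' fun n => hpow (m := t) hb' (by rw [← mul_assoc]; exact hab n)
    | succ s ih =>
      have hb1 : π ^ s * b ≠ 0 := by
        intro h0
        exact hb (by rw [pow_succ', mul_assoc, h0, mul_zero])
      have ha : π ∣ a := by
        by_contra ha
        refine hc (h.haus _ fun n => ?_)
        have hn : ¬ π ∣ a ^ n := fun hd => ha (hprime.dvd_of_dvd_pow hd)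
        refine hprime.pow_dvd_of_dvd_mul_right n hn (dvd_trans ?_ (hab n))
        exact pow_dvd_pow_of_dvd (by rw [pow_succ', mul_assoc]; exact dvd_mul_right _ _) n
      obtain ⟨a, rfl⟩ := ha
      rw [pow_succ', mul_assoc]
      refine mul_dvd_mul_left π (ih hb1 fun n => ?_)
      obtain ⟨e, he⟩ := hab n
      refine ⟨e, mul_left_cancel₀ (pow_ne_zero n hπ) ?_⟩
      calc π ^ n * (π ^ t * c * a ^ n) = π ^ t * c * (π * a) ^ n := by ring
        _ = π ^ n * ((π ^ s * b) ^ n * e) := by rw [he]; ring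
  rw [isIntegrallyClosed_iff (FractionRing R)]
  intro x hx
  obtain ⟨c, hc, hcx⟩ := hx.isAlmostIntegral
  obtain ⟨a, b, hb, rfl⟩ := IsFractionRing.div_surjective (A := R) x
  have hbK : algebraMap R (FractionRing R) b ≠ 0 := by
    simpa using nonZeroDivisors.ne_zero hb
  obtain ⟨q, rfl⟩ : b ∣ a := by
    refine hgen (nonZeroDivisors.ne_zero hb) (nonZeroDivisors.ne_zero hc) fun n => ?_
    obtain ⟨e, he⟩ := hcx n
    refine ⟨e, IsFractionRing.injective R (FractionRing R) ?_⟩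
    rw [Algebra.smul_def, div_pow, mul_div_assoc', eq_div_iff (pow_ne_zero _ hbK)] at he
    simp only [map_mul, map_pow]
    rw [← he, mul_comm]
  exact ⟨q, by rw [map_mul, mul_div_cancel_left₀ _ hbK]⟩

end Normal

/-! ### Restricted power series over `ℤ_p` -/

section PadicRestricted

variable {p : ℕ} [Fact p.Prime]

theorem toZMod_eq_zero_iff (z : ℤ_[p]) : PadicInt.toZMod z = 0 ↔ (p : ℤ_[p]) ∣ z := by
  rw [← RingHom.mem_ker, PadicInt.ker_toZMod, PadicInt.maximalIdeal_eq_span_p,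
    Ideal.mem_span_singleton]

theorem RestrictedSeries.exists_reduction (σ : Type*) :
    ∃ red : RestrictedSeries (p : ℤ_[p]) σ →+* MvPolynomial σ (ZMod p),
      Function.Surjective red ∧
      (∀ P, red (RestrictedSeries.ofPolynomial P) = MvPolynomial.map PadicInt.toZMod P) ∧
      ∀ F, red F = 0 ↔ (p : RestrictedSeries (p : ℤ_[p]) σ) ∣ F := by
  have hp := natCast_mem_nonZeroDivisors_padicInt (p := p)
  let := (PadicInt.toZMod (p := p)).toAlgebra
  have h0 : (p : MvPolynomial σ (ZMod p)) = 0 := by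
    rw [← map_natCast (MvPolynomial.C (σ := σ) (R := ZMod p)), ZMod.natCast_self, map_zero]
  -- Here p = 0, so completeness is trivial, and evaluation at the variables defines the reduction
  -- map.
  have hc : IsPiComplete (p : MvPolynomial σ (ZMod p)) :=
    { haus := fun x hx => by simpa [h0] using hx 1
      prec := fun g => ⟨g 0, fun n => by
        rcases n with _ | n
        · simp
        · rw [Finset.sum_range_succ']; simp⟩ }
  obtain ⟨f, hf⟩ := RestrictedSeries.exists_eval hc (MvPolynomial.X : σ → MvPolynomial σ (ZMod p))
  have hf' : ∀ P, f (RestrictedSeries.ofPolynomial P) = MvPolynomial.map PadicInt.toZMod P := by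
    intro P
    rw [hf]
    induction P using MvPolynomial.induction_on with
    | C a => rw [MvPolynomial.aeval_C, MvPolynomial.map_C]; rfl
    | add P Q hP hQ => rw [map_add, map_add, hP, hQ]
    | mul_X P i hP => rw [map_mul, map_mul, hP, MvPolynomial.aeval_X, MvPolynomial.map_X]
  refine ⟨f, fun Q => ?_, hf', fun F => ⟨fun hF => ?_, ?_⟩⟩
  · obtain ⟨P, hP⟩ := MvPolynomial.map_surjective _
      (ZMod.ringHom_surjective (PadicInt.toZMod (p := p))) Q
    exact ⟨RestrictedSeries.ofPolynomial P, (hf' P).trans hP⟩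
  · obtain ⟨P, hP⟩ := RestrictedSeries.exists_polynomial hp F 1
    rw [map_natCast, pow_one] at hP
    have h1 : f (RestrictedSeries.ofPolynomial P) = 0 := by
      obtain ⟨G, hG⟩ := hP
      have h2 : f F - f (RestrictedSeries.ofPolynomial P) = 0 := by
        rw [← map_sub, hG, map_mul, map_natCast, h0, zero_mul]
      have hF' : f F = 0 := hF
      rwa [hF', zero_sub, neg_eq_zero] at h2
    have h3 := (RestrictedSeries.pow_dvd_ofPolynomial_iff hp P 1).2 (by
      rw [MvPolynomial.C_dvd_iff_dvd_coeff]
      intro m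
      rw [pow_one, ← toZMod_eq_zero_iff, ← MvPolynomial.coeff_map, ← hf', h1]
      simp)
    rw [map_natCast, pow_one] at h3
    simpa using dvd_add hP h3
  · rintro ⟨G, rfl⟩
    change f _ = 0
    rw [map_mul, map_natCast, h0, zero_mul]

theorem RestrictedSeries.isPiComplete_padicInt (σ : Type*) :
    IsPiComplete (p : RestrictedSeries (p : ℤ_[p]) σ) := by
  simpa using RestrictedSeries.isPiComplete (σ := σ) (PadicOpAlg.isPiComplete_padicInt (p := p))
    natCast_mem_nonZeroDivisors_padicInt

theorem RestrictedSeries.natCast_mem_nonZeroDivisors (σ : Type*) :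
    (p : RestrictedSeries (p : ℤ_[p]) σ) ∈ nonZeroDivisors _ := by
  simpa using RestrictedSeries.mem_nonZeroDivisors (σ := σ)
    (natCast_mem_nonZeroDivisors_padicInt (p := p))

instance RestrictedSeries.isDomain_padicInt (σ : Type*) :
    IsDomain (RestrictedSeries (p : ℤ_[p]) σ) := by
  obtain ⟨red, -, -, hker⟩ := RestrictedSeries.exists_reduction (p := p) σ
  exact (RestrictedSeries.isPiComplete_padicInt σ).isDomain red
    (RestrictedSeries.natCast_mem_nonZeroDivisors σ) hker

theorem RestrictedSeries.isTopFinite_padicInt (σ : Type*) [Finite σ] :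
    IsTopFinite p (RestrictedSeries (p : ℤ_[p]) σ) :=
  PadicOpAlg.isTopFinite_padicInt.restrictedSeries natCast_mem_nonZeroDivisors_padicInt σ

instance RestrictedSeries.isNoetherianRing_padicInt (σ : Type*) [Finite σ] :
    IsNoetherianRing (RestrictedSeries (p : ℤ_[p]) σ) :=
  (RestrictedSeries.isTopFinite_padicInt σ).isNoetherianRing

instance RestrictedSeries.isIntegrallyClosed_padicInt (σ : Type*) [Finite σ] :
    IsIntegrallyClosed (RestrictedSeries (p : ℤ_[p]) σ) := by
  obtain ⟨red, hsurj, -, hker⟩ := RestrictedSeries.exists_reduction (p := p) σ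
  exact (RestrictedSeries.isPiComplete_padicInt σ).isIntegrallyClosed red
    (nonZeroDivisors.ne_zero (RestrictedSeries.natCast_mem_nonZeroDivisors σ)) hsurj hker

end PadicRestricted

/-! ### Noether normalization and residue fields -/

section Noether

variable {p : ℕ} [Fact p.Prime] {S : Type*} [CommRing S] [Algebra ℤ_[p] S]

theorem algebraMap_eq_castHom_toZMod {T : Type*} [CommRing T] [Algebra ℤ_[p] T] [CharP T p]
    (z : ℤ_[p]) : algebraMap ℤ_[p] T z = ZMod.castHom dvd_rfl T (PadicInt.toZMod z) := by
  have h1 := PadicInt.sub_zmodRepr_mem z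
  have h2 := h1
  rw [← PadicInt.ker_toZMod, RingHom.mem_ker, map_sub, sub_eq_zero, map_natCast] at h2
  rw [PadicInt.maximalIdeal_eq_span_p, Ideal.mem_span_singleton] at h1
  obtain ⟨w, hw⟩ := h1
  rw [h2, map_natCast]
  conv_lhs => rw [sub_eq_iff_eq_add.1 hw, map_add, map_mul, map_natCast, map_natCast,
    CharP.cast_eq_zero, zero_mul, zero_add]

/-- **Noether normalization** for algebras topologically of finite type over `ℤ_p`. -/
theorem IsTopFinite.exists_noether (h : IsTopFinite p S) (hp : (p : S) ∈ nonZeroDivisors S)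
    (hu : ¬ IsUnit (p : S)) :
    ∃ (d : ℕ) (f : RestrictedSeries (p : ℤ_[p]) (Fin d) →ₐ[ℤ_[p]] S),
      Function.Injective f ∧ f.toRingHom.Finite := by
  have hpZ := natCast_mem_nonZeroDivisors_padicInt (p := p)
  let T := S ⧸ Ideal.span {(p : S)}
  have : Nontrivial T := Ideal.Quotient.nontrivial_iff.2 (by rwa [Ne, Ideal.span_singleton_eq_top])
  have hpT : (p : T) = 0 := by
    rw [← map_natCast (Ideal.Quotient.mk (Ideal.span {(p : S)})), Ideal.Quotient.eq_zero_iff_mem]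
    exact Ideal.mem_span_singleton_self _
  have : CharP T p := (CharP.charP_iff_prime_eq_zero Fact.out).2 hpT
  let : Algebra (ZMod p) T := (ZMod.castHom dvd_rfl T).toAlgebra
  let : Algebra ℤ_[p] (ZMod p) := (PadicInt.toZMod (p := p)).toAlgebra
  have : IsScalarTower ℤ_[p] (ZMod p) T :=
    IsScalarTower.of_algebraMap_eq fun z => algebraMap_eq_castHom_toZMod z
  have hft : Algebra.FiniteType ℤ_[p] T := h.finiteType
  have := Algebra.FiniteType.of_restrictScalars_finiteType ℤ_[p] (ZMod p) T
  -- Noether normalization over `ZMod p` for S/p; lifting the images of the variables to S and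
  -- evaluating restricted series there gives f, which reduces to g modulo p.
  obtain ⟨d, g, hginj, hgfin⟩ := exists_finite_inj_algHom_of_fg (ZMod p) T
  choose y hy using fun i => Ideal.Quotient.mk_surjective (g (MvPolynomial.X i))
  obtain ⟨f, hf⟩ := RestrictedSeries.exists_eval h.complete y
  let mk : S →+* T := Ideal.Quotient.mk _
  have hcomm : ∀ P, mk (f (RestrictedSeries.ofPolynomial P))
      = g (MvPolynomial.map PadicInt.toZMod P) := by
    intro P
    rw [hf]
    induction P using MvPolynomial.induction_on with
    | C a =>
      rw [MvPolynomial.aeval_C, MvPolynomial.map_C]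
      exact (algebraMap_eq_castHom_toZMod a).trans (g.commutes _).symm
    | add P Q hP hQ => rw [map_add, map_add, map_add, map_add, hP, hQ]
    | mul_X P i hP =>
      rw [map_mul, map_mul, map_mul, map_mul, hP, MvPolynomial.aeval_X, MvPolynomial.map_X]
      exact congrArg _ (hy i)
  have hR := RestrictedSeries.isPiComplete_padicInt (p := p) (Fin d)
  refine ⟨d, f, ?_, ?_⟩
  · rw [injective_iff_map_eq_zero]
    intro F hF
    by_contra hF0
    obtain ⟨k, G, rfl, hG⟩ := hR.exists_eq_pow_mul hF0
    rw [map_mul, map_pow, map_natCast] at hF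
    have hfG := (mem_nonZeroDivisors_iff.1 (pow_mem hp k)).1 _ hF
    obtain ⟨P, hP⟩ := RestrictedSeries.exists_polynomial hpZ G 1
    rw [map_natCast, pow_one] at hP
    have h1 : g (MvPolynomial.map PadicInt.toZMod P) = 0 := by
      obtain ⟨H, hH⟩ := hP
      have h2 := congrArg (fun x => mk (f x)) hH
      simp only [map_sub, map_mul, map_natCast, hpT, zero_mul, hfG, zero_sub, map_neg,
        neg_eq_zero] at h2
      rw [← hcomm]; exact h2
    have h2 : MvPolynomial.map PadicInt.toZMod P = 0 := hginj (h1.trans (map_zero g).symm)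
    have h3 := (RestrictedSeries.pow_dvd_ofPolynomial_iff hpZ P 1).2 (by
      rw [MvPolynomial.C_dvd_iff_dvd_coeff]
      intro m
      rw [pow_one, ← toZMod_eq_zero_iff, ← MvPolynomial.coeff_map, h2]
      simp)
    rw [map_natCast, pow_one] at h3
    exact hG (by simpa using dvd_add hP h3)
  · let := f.toRingHom.toAlgebra
    let := g.toRingHom.toAlgebra
    have hgf : Module.Finite (MvPolynomial (Fin d) (ZMod p)) T := hgfin
    obtain ⟨r, t, ht⟩ := Module.Finite.exists_fin (R := MvPolynomial (Fin d) (ZMod p)) (M := T)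
    choose m hm using fun i => Ideal.Quotient.mk_surjective (t i)
    have hsep : IsSeparated (p : RestrictedSeries (p : ℤ_[p]) (Fin d)) S := by
      intro x hx
      refine h.complete.haus x fun k => ?_
      obtain ⟨z, rfl⟩ := hx k
      refine ⟨z, ?_⟩
      rw [Algebra.smul_def, map_pow, map_natCast]
    -- Lifts of module generators of S/p generate S, by successive approximation.
    have key := span_eq_top_of_complete hR hsep m fun x => by
      have hx : mk x ∈ Submodule.span (MvPolynomial (Fin d) (ZMod p)) (Set.range t) := by
        rw [ht]; trivial
      obtain ⟨c, hc⟩ := (Submodule.mem_span_range_iff_exists_fun _).1 hx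
      choose P hP using fun i => MvPolynomial.map_surjective _
        (ZMod.ringHom_surjective (PadicInt.toZMod (p := p))) (c i)
      have h1 : mk (x - ∑ i, RestrictedSeries.ofPolynomial (π := (p : ℤ_[p])) (P i) • m i) = 0 := by
        rw [map_sub, map_sum, ← hc, sub_eq_zero]
        refine Finset.sum_congr rfl fun i _ => ?_
        rw [Algebra.smul_def, Algebra.smul_def, map_mul]
        change g (c i) * t i = mk (f _) * mk (m i)
        rw [hcomm, hP, ← hm i]
      obtain ⟨z, hz⟩ := Ideal.mem_span_singleton'.1 (Ideal.Quotient.eq_zero_iff_mem.1 h1)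
      refine ⟨fun i => RestrictedSeries.ofPolynomial (P i), z, ?_⟩
      rw [Algebra.smul_def (p : RestrictedSeries (p : ℤ_[p]) (Fin d)), map_natCast, mul_comm, hz]
      exact (add_sub_cancel _ x).symm
    exact ⟨Submodule.fg_def.2 ⟨_, Set.finite_range m, key⟩⟩

theorem IsPiComplete.not_isUnit [Nontrivial S] {π : S} (h : IsPiComplete π) : ¬ IsUnit π := by
  intro hu
  obtain ⟨y, hy⟩ := hu.exists_right_inv
  obtain ⟨z, hz⟩ := h.exists_mul_eq_one y
  rw [hy, sub_self, zero_mul] at hz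
  exact zero_ne_one hz

/-- If a domain `S` topologically of finite type over `ℤ_p` becomes a field after inverting `p`,
then it is finite over `ℤ_p`. -/
theorem IsTopFinite.finite_of_forall_dvd_pow (h : IsTopFinite p S) [IsDomain S]
    (hp : (p : S) ≠ 0) (hS : ∀ x : S, x ≠ 0 → ∃ k : ℕ, x ∣ (p : S) ^ k) :
    Module.Finite ℤ_[p] S := by
  obtain ⟨d, f, hinj, hfin⟩ := h.exists_noether (mem_nonZeroDivisors_of_ne_zero hp)
    h.complete.not_isUnit
  let R : Type _ := RestrictedSeries (p : ℤ_[p]) (Fin d)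
  let : Algebra R S := f.toRingHom.toAlgebra
  have hfin' : Module.Finite R S := hfin
  have : IsScalarTower ℤ_[p] R S := IsScalarTower.of_algebraMap_eq fun z => (f.commutes z).symm
  -- If there were a variable x, no power of p would be a multiple of it (compare constant
  -- coefficients), so some prime Q contains x but not p. A prime of S over Q contains f x, hence
  -- the power of p that f x divides, a contradiction.
  have hd : d = 0 := by
    by_contra hd
    let i : Fin d := ⟨0, Nat.pos_of_ne_zero hd⟩
    let x : R := RestrictedSeries.ofPolynomial (MvPolynomial.X i)
    have hx0 : x ≠ 0 := by
      intro h0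
      have := congrArg (RestrictedSeries.coeff (Finsupp.single i 1)) h0
      rw [RestrictedSeries.coeff_ofPolynomial, map_zero, MvPolynomial.coeff_X,
        if_pos rfl] at this
      exact one_ne_zero this
    obtain ⟨k, u, hu⟩ := hS (f x) fun h0 => hx0 (hinj (h0.trans (map_zero f).symm))
    have hdisj : Disjoint ((Ideal.span {x} : Ideal R) : Set R) (Submonoid.powers (p : R)) := by
      rw [Set.disjoint_left]
      rintro z hz ⟨l, hl⟩
      obtain ⟨G, hG⟩ := Ideal.mem_span_singleton.1 hz
      have h1 : (p : R) ^ l = x * G := hl.trans hG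
      have h2 : RestrictedSeries.coeff 0 ((p : R) ^ l) = (p : ℤ_[p]) ^ l := by
        have := RestrictedSeries.coeff_algebraMap_mul (π := (p : ℤ_[p])) (σ := Fin d)
          0 ((p : ℤ_[p]) ^ l) 1
        rw [map_pow, map_natCast, mul_one] at this
        rw [this]
        have h3 : RestrictedSeries.coeff 0 (1 : R) = 1 := by
          change MvPowerSeries.coeff 0 (1 : MvPowerSeries (Fin d) ℤ_[p]) = 1
          exact MvPowerSeries.coeff_zero_one
        rw [h3, mul_one]
      have h4 : RestrictedSeries.coeff 0 (x * G) = 0 := by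
        change MvPowerSeries.coeff 0 (x.1 * G.1) = 0
        rw [MvPowerSeries.coeff_zero_eq_constantCoeff_apply, map_mul]
        have : MvPowerSeries.constantCoeff x.1 = 0 := by
          have := RestrictedSeries.coeff_ofPolynomial (π := (p : ℤ_[p]))
            (MvPolynomial.X i : MvPolynomial (Fin d) ℤ_[p]) 0
          rw [MvPolynomial.coeff_zero_X] at this
          exact (MvPowerSeries.coeff_zero_eq_constantCoeff_apply _).symm.trans this
        rw [this, zero_mul]
      rw [h1, h4] at h2
      exact pow_ne_zero l (PadicInt.prime_p).ne_zero h2.symm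
    obtain ⟨Q, hQ, hxQ, hQdisj⟩ := Ideal.exists_le_prime_disjoint _ _ hdisj
    have hint : Algebra.IsIntegral R S := inferInstance
    obtain ⟨Q', hQ', -, hcomap⟩ := Ideal.exists_ideal_over_prime_of_isIntegral Q (⊥ : Ideal S) (by
      intro z hz
      have hz' : f z = 0 := hz
      rw [hinj (hz'.trans (map_zero f).symm)]
      exact Q.zero_mem)
    have hfx : f x ∈ Q' := by
      have : x ∈ Q'.comap (algebraMap R S) := by
        rw [hcomap]; exact hxQ (Ideal.mem_span_singleton_self x)
      exact this
    have hpk : (p : S) ^ k ∈ Q' := by rw [hu]; exact Q'.mul_mem_right _ hfx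
    have hpk' : (p : R) ^ k ∈ Q := by
      rw [← hcomap, Ideal.mem_comap, map_pow, map_natCast]; exact hpk
    exact Set.disjoint_left.1 hQdisj hpk' ⟨k, rfl⟩
  subst hd
  have : Module.Finite ℤ_[p] R := by
    refine Module.Finite.of_surjective (Algebra.linearMap ℤ_[p] R) fun F => ?_
    refine ⟨RestrictedSeries.coeff 0 F, RestrictedSeries.ext fun m => ?_⟩
    rw [Subsingleton.elim m 0]
    change MvPowerSeries.coeff 0 (algebraMap ℤ_[p] (MvPowerSeries (Fin 0) ℤ_[p]) _) = _
    rw [MvPowerSeries.algebraMap_apply, MvPowerSeries.coeff_zero_C]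
    rfl
  exact Module.Finite.trans R S

end Noether

/-! ### Integral models of affinoid algebras -/

section Model

variable {p : ℕ} [Fact p.Prime] {S A : Type*} [CommRing S] [CommRing A] [Algebra ℤ_[p] S]
  [Algebra ℤ_[p] A] [Algebra ℚ_[p] A] [IsScalarTower ℤ_[p] ℚ_[p] A] [Algebra S A]
  [IsScalarTower ℤ_[p] S A]

variable (p S A) in
/-- `S` is topologically of finite type over `ℤ_p`, and `A` arises from `S` by inverting the
nonzerodivisor `p`. -/
structure IsModel : Prop where
  topFinite : IsTopFinite p S
  injective : Function.Injective (algebraMap S A)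
  exists_pow : ∀ a : A, ∃ (k : ℕ) (s : S), (p : A) ^ k * a = algebraMap S A s

omit [Algebra S A] in
theorem isUnit_natCast_of_algebra : IsUnit (p : A) := by
  have : IsUnit (p : ℚ_[p]) := IsUnit.mk0 _ (by exact_mod_cast (Fact.out : p.Prime).ne_zero)
  simpa using this.map (algebraMap ℚ_[p] A)

theorem IsModel.mem_nonZeroDivisors (h : IsModel p S A) : (p : S) ∈ nonZeroDivisors S := by
  rw [mem_nonZeroDivisors_iff_right]
  intro x hx
  refine h.injective ?_
  rw [map_zero]
  have := congrArg (algebraMap S A) hx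
  rw [map_mul, map_natCast, map_zero] at this
  exact (isUnit_natCast_of_algebra (p := p)).mul_left_eq_zero.1 this

theorem IsModel.isLocalization (h : IsModel p S A) : IsLocalization.Away (p : S) A where
  map_units := by
    rintro ⟨_, k, rfl⟩
    change IsUnit (algebraMap S A ((p : S) ^ k))
    rw [map_pow, map_natCast]
    exact isUnit_natCast_of_algebra.pow k
  surj a := by
    obtain ⟨k, s, hs⟩ := h.exists_pow a
    refine ⟨(s, ⟨(p : S) ^ k, k, rfl⟩), ?_⟩
    change a * algebraMap S A ((p : S) ^ k) = _
    rw [map_pow, map_natCast, mul_comm, hs]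
  exists_of_eq hxy := ⟨1, by rw [h.injective hxy]⟩

/-- The image of the model in a residue field is finite over `ℤ_p`. -/
theorem IsModel.finite_range (h : IsModel p S A) (m : Ideal A) [m.IsMaximal] :
    Module.Finite ℤ_[p] (IsScalarTower.toAlgHom ℤ_[p] S (A ⧸ m)).range := by
  let := Ideal.Quotient.field m
  let φ := IsScalarTower.toAlgHom ℤ_[p] S (A ⧸ m)
  have hp : (p : A ⧸ m) ≠ 0 := (isUnit_natCast_of_algebra (p := p)).ne_zero
  refine (h.topFinite.of_surjective φ.rangeRestrict φ.rangeRestrict_surjective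
    ).finite_of_forall_dvd_pow ?_ ?_
  · intro h0
    exact hp (by simpa using congrArg Subtype.val h0)
  · rintro ⟨x, hx⟩ hx0
    have hx0' : x ≠ 0 := fun h' => hx0 (Subtype.ext h')
    obtain ⟨a, ha⟩ := Ideal.Quotient.mk_surjective x⁻¹
    obtain ⟨k, s, hs⟩ := h.exists_pow a
    refine ⟨k, ⟨φ s, s, rfl⟩, Subtype.ext ?_⟩
    have h1 : φ s = (p : A ⧸ m) ^ k * x⁻¹ := by
      rw [← ha, ← map_natCast (Ideal.Quotient.mk m), ← map_pow, ← map_mul, hs]; rfl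
    change (((p : φ.range) ^ k : φ.range) : A ⧸ m) = x * φ s
    rw [h1, mul_left_comm, mul_inv_cancel₀ hx0', mul_one]
    simp

theorem IsModel.isIntegral_quotient (h : IsModel p S A) (P : Ideal A)
    (hP : ∀ s : S, IsIntegral ℤ_[p] (Ideal.Quotient.mk P (algebraMap S A s))) :
    Algebra.IsIntegral ℚ_[p] (A ⧸ P) := by
  refine ⟨fun x => ?_⟩
  obtain ⟨a, rfl⟩ := Ideal.Quotient.mk_surjective x
  obtain ⟨k, s, hs⟩ := h.exists_pow a
  have h1 : IsIntegral ℚ_[p] (Ideal.Quotient.mk P (algebraMap S A s)) := (hP s).tower_top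
  have hp0 : (p : ℚ_[p]) ≠ 0 := by exact_mod_cast (Fact.out : p.Prime).ne_zero
  have h2 : Ideal.Quotient.mk P a
      = algebraMap ℚ_[p] (A ⧸ P) ((p : ℚ_[p]) ^ k)⁻¹ * Ideal.Quotient.mk P (algebraMap S A s) := by
    rw [← hs, map_mul, map_pow, map_natCast]
    rw [← mul_assoc, ← map_natCast (algebraMap ℚ_[p] (A ⧸ P)), ← map_pow, ← map_mul,
      inv_mul_cancel₀ (pow_ne_zero k hp0), map_one, one_mul]
  rw [h2]
  exact isIntegral_algebraMap.mul h1

theorem RestrictedSeries.coeff_X_mul {R : Type*} [CommRing R] {π : R}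
    (H : RestrictedSeries π Unit) (n : ℕ) :
    coeff (Finsupp.single () (n + 1)) (ofPolynomial (MvPolynomial.X ()) * H)
      = coeff (Finsupp.single () n) H := by
  have hX : (ofPolynomial (π := π) (MvPolynomial.X () : MvPolynomial Unit R)).1 = PowerSeries.X := by
    refine MvPowerSeries.ext fun m => ?_
    refine (coeff_ofPolynomial (π := π) (MvPolynomial.X ()) m).trans ?_
    classical
    rw [MvPolynomial.coeff_X, PowerSeries.X, MvPowerSeries.coeff_X]
    simp only [eq_comm]
  change PowerSeries.coeff (n + 1) (_ * H.1) = PowerSeries.coeff n H.1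
  rw [hX, PowerSeries.coeff_succ_X_mul]

theorem RestrictedSeries.coeff_zero_X_mul {R : Type*} [CommRing R] {π : R}
    (H : RestrictedSeries π Unit) :
    coeff (Finsupp.single () 0) (ofPolynomial (MvPolynomial.X ()) * H) = 0 := by
  rw [Finsupp.single_zero]
  change MvPowerSeries.coeff 0 (_ * H.1) = 0
  rw [MvPowerSeries.coeff_zero_eq_constantCoeff_apply, map_mul]
  have : MvPowerSeries.constantCoeff
      (ofPolynomial (π := π) (MvPolynomial.X () : MvPolynomial Unit R)).1 = 0 := by
    rw [← MvPowerSeries.coeff_zero_eq_constantCoeff_apply]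
    exact (coeff_ofPolynomial (π := π) (MvPolynomial.X ()) 0).trans (MvPolynomial.coeff_zero_X ())
  rw [this, zero_mul]

/-- If `p ^ N` is a multiple of `s Y - p ^ k` in `S⟨Y⟩`, then some power of `s / p ^ k` lies
in `S`. -/
theorem exists_pow_mem_of_dvd {g : A} {s : S} {k N : ℕ}
    (hs : (p : A) ^ k * g = algebraMap S A s)
    (hdvd : algebraMap S (RestrictedSeries (p : S) Unit) s *
      RestrictedSeries.ofPolynomial (MvPolynomial.X ()) - algebraMap S _ ((p : S) ^ k)
        ∣ algebraMap S _ ((p : S) ^ N)) :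
    ∃ j ≥ 1, g ^ j ∈ (algebraMap S A).range := by
  obtain ⟨H, hH⟩ := hdvd
  let c : ℕ → S := fun n => RestrictedSeries.coeff (Finsupp.single () n) H
  have hu : IsUnit (p : A) := isUnit_natCast_of_algebra
  have hco : ∀ n, RestrictedSeries.coeff (Finsupp.single () n)
      (algebraMap S (RestrictedSeries (p : S) Unit) ((p : S) ^ N))
      = s * RestrictedSeries.coeff (Finsupp.single () n)
          (RestrictedSeries.ofPolynomial (MvPolynomial.X ()) * H) - (p : S) ^ k * c n := by
    intro n
    rw [hH, sub_mul, map_sub, mul_assoc, RestrictedSeries.coeff_algebraMap_mul,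
      RestrictedSeries.coeff_algebraMap_mul]
  have hC : ∀ n, RestrictedSeries.coeff (Finsupp.single () n)
      (algebraMap S (RestrictedSeries (p : S) Unit) ((p : S) ^ N))
      = if n = 0 then (p : S) ^ N else 0 := by
    intro n
    change PowerSeries.coeff n (algebraMap S (PowerSeries S) ((p : S) ^ N)) = _
    rw [PowerSeries.algebraMap_apply]
    exact PowerSeries.coeff_C n _
  have h0 : (p : S) ^ k * c 0 = -(p : S) ^ N := by
    have := hco 0
    rw [hC, RestrictedSeries.coeff_zero_X_mul, if_pos rfl, mul_zero, zero_sub] at this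
    rw [this, neg_neg]
  have hsucc : ∀ n, (p : S) ^ k * c (n + 1) = s * c n := by
    intro n
    have := hco (n + 1)
    rw [hC, RestrictedSeries.coeff_X_mul, if_neg (Nat.succ_ne_zero n)] at this
    exact (sub_eq_zero.1 this.symm).symm
  -- Formally H = p^N / (sY - p^k) = -p^(N-k) ∑ gⁿ Yⁿ.
  have hpow : ∀ n, (p : A) ^ k * algebraMap S A (c n) = -(p : A) ^ N * g ^ n := by
    intro n
    induction n with
    | zero => simpa using congrArg (algebraMap S A) h0
    | succ n ih =>
      have h1 := congrArg (algebraMap S A) (hsucc n)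
      rw [map_mul, map_mul, map_pow, map_natCast, ← hs] at h1
      rw [h1, pow_succ, ← mul_assoc (-(p : A) ^ N), ← ih]; ring
  -- The coefficients of H tend to zero, so some c (n + 1) is divisible by p^N; cancelling p^N
  -- exhibits g^(n+1) as an element of S. The shift keeps the exponent positive.
  obtain ⟨n, hn⟩ := (((H.2 N).preimage
    (f := fun n : ℕ => Finsupp.single () (n + 1)) (by
      intro a _ b _ hab
      simpa using Finsupp.single_injective _ hab)).infinite_compl).nonempty
  have hn' : (p : S) ^ N ∣ c (n + 1) := by
    by_contra hcon
    exact hn hcon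
  obtain ⟨w, hw⟩ := hn'
  refine ⟨n + 1, Nat.succ_le_succ (Nat.zero_le n), -((p : S) ^ k * w), ?_⟩
  refine (hu.pow N).mul_left_cancel ?_
  have h1 := hpow (n + 1)
  rw [hw] at h1
  simp only [map_mul, map_pow, map_natCast, map_neg] at h1 ⊢
  linear_combination -h1

/-- If no power of `p` is a multiple of `v`, then `v` lies in a prime ideal `Q` such that `R ⧸ Q`
is finite over `ℤ_p` and of characteristic zero. -/
theorem IsTopFinite.exists_prime_finite {R : Type*} [CommRing R] [Algebra ℤ_[p] R]
    (h : IsTopFinite p R) {v : R} (hv : ∀ N, ¬ v ∣ (p : R) ^ N) :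
    ∃ Q : Ideal R, Q.IsPrime ∧ v ∈ Q ∧ (p : R) ∉ Q ∧ Module.Finite ℤ_[p] (R ⧸ Q) := by
  have := h.isNoetherianRing
  -- Take Q maximal among the ideals that contain v and no power of p. Maximality makes Q prime and
  -- makes every nonzero element of R/Q divide a power of p, so R/Q is finite over `ℤ_p`.
  obtain ⟨Q, ⟨hvQ, hQd⟩, hQmax⟩ : ∃ Q ∈ {J : Ideal R | v ∈ J ∧ ∀ N, (p : R) ^ N ∉ J},
      ∀ J ∈ {J : Ideal R | v ∈ J ∧ ∀ N, (p : R) ^ N ∉ J}, ¬ Q < J :=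
    set_has_maximal_iff_noetherian.2 (inferInstanceAs (IsNoetherian R R)) _
      ⟨Ideal.span {v}, Ideal.mem_span_singleton_self v, fun N hN =>
        hv N (Ideal.mem_span_singleton.1 hN)⟩
  have hmeet : ∀ J : Ideal R, Q < J → ∃ N, (p : R) ^ N ∈ J := by
    intro J hJ
    by_contra! hcon
    exact hQmax J ⟨hJ.le hvQ, hcon⟩ hJ
  have hprime : Q.IsPrime := by
    refine Ideal.isPrime_of_maximally_disjoint Q (Submonoid.powers (p : R)) ?_ fun J hJ hd => ?_
    · rw [Set.disjoint_left]
      rintro z hz ⟨N, rfl⟩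
      exact hQd N hz
    · obtain ⟨N, hN⟩ := hmeet J hJ
      exact Set.disjoint_left.1 hd hN ⟨N, rfl⟩
  have hpQ : (p : R) ∉ Q := fun h0 => hQd 1 (by rwa [pow_one])
  have hpB : (p : R ⧸ Q) ≠ 0 := by
    intro h0
    rw [← map_natCast (Ideal.Quotient.mk Q), Ideal.Quotient.eq_zero_iff_mem] at h0
    exact hpQ h0
  refine ⟨Q, hprime, hvQ, hpQ, (h.of_surjective (Ideal.Quotient.mkₐ ℤ_[p] Q)
      Ideal.Quotient.mk_surjective).finite_of_forall_dvd_pow hpB fun x hx => ?_⟩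
  obtain ⟨F, rfl⟩ := Ideal.Quotient.mk_surjective x
  have hF : F ∉ Q := fun hF => hx (Ideal.Quotient.eq_zero_iff_mem.2 hF)
  obtain ⟨N, hN⟩ := hmeet (Q ⊔ Ideal.span {F}) (lt_of_le_of_ne le_sup_left fun he => hF (by
    rw [he]; exact Ideal.mem_sup_right (Ideal.mem_span_singleton_self F)))
  obtain ⟨q, hq, z, hz, hqz⟩ := Submodule.mem_sup.1 hN
  obtain ⟨G, rfl⟩ := Ideal.mem_span_singleton.1 hz
  refine ⟨N, Ideal.Quotient.mk Q G, ?_⟩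
  rw [← map_mul, ← map_natCast (Ideal.Quotient.mk Q), ← map_pow, ← hqz, map_add,
    Ideal.Quotient.eq_zero_iff_mem.2 hq, zero_add]

/-- If `p ^ N` is never a multiple of `s Y - p ^ k` in `S⟨Y⟩`, then at some maximal ideal the
inverse of `s / p ^ k` is integral over `ℤ_p`. -/
theorem IsModel.exists_maximal_of_not_dvd (h : IsModel p S A) {g : A} {s : S} {k : ℕ}
    (hs : (p : A) ^ k * g = algebraMap S A s)
    (hdvd : ∀ N, ¬ algebraMap S (RestrictedSeries (p : S) Unit) s *
      RestrictedSeries.ofPolynomial (MvPolynomial.X ()) - algebraMap S _ ((p : S) ^ k)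
        ∣ algebraMap S _ ((p : S) ^ N)) :
    ∃ m : Ideal A, m.IsMaximal ∧ ∃ y : A ⧸ m, IsIntegral ℤ_[p] y ∧ Ideal.Quotient.mk m g * y = 1 := by
  set Y : RestrictedSeries (p : S) Unit := RestrictedSeries.ofPolynomial (MvPolynomial.X ()) with hY
  set v : RestrictedSeries (p : S) Unit :=
    algebraMap S _ s * Y - algebraMap S _ ((p : S) ^ k) with hv
  obtain ⟨Q, hprime, hvQ, hpQ, hBfin⟩ :=
    (h.topFinite.restrictedSeries h.mem_nonZeroDivisors Unit).exists_prime_finite (v := v)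
      fun N hN => hdvd N (by rwa [map_pow, map_natCast])
  let B := RestrictedSeries (p : S) Unit ⧸ Q
  let L := FractionRing B
  have hpB : (p : B) ≠ 0 := by
    intro h0
    rw [← map_natCast (Ideal.Quotient.mk Q), Ideal.Quotient.eq_zero_iff_mem] at h0
    exact hpQ h0
  have hBint : ∀ b : B, IsIntegral ℤ_[p] (algebraMap B L b) := fun b =>
    (Algebra.IsIntegral.isIntegral (R := ℤ_[p]) b).map (IsScalarTower.toAlgHom ℤ_[p] B L)
  let φ : S →+* L := (algebraMap B L).comp
    ((Ideal.Quotient.mk Q).comp (algebraMap S (RestrictedSeries (p : S) Unit)))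
  have hpL : (p : L) ≠ 0 := fun h0 =>
    hpB (IsFractionRing.injective B L (by rw [map_natCast, map_zero, h0]))
  have hφp : IsUnit (φ (p : S)) := by
    rw [map_natCast]; exact IsUnit.mk0 _ hpL
  have hloc := h.isLocalization
  -- Since p is invertible in L, the map S → B → L extends to A. Its kernel is the point sought:
  -- A/ker is a domain integral over `ℚ_p`, hence a field, and the image of Y is the integral
  -- inverse of g.
  let ψ₀ : A →+* L := IsLocalization.Away.lift (p : S) hφp
  have hψ₀ : ∀ t, ψ₀ (algebraMap S A t) = φ t := IsLocalization.Away.lift_eq (p : S) hφp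
  let ψ : A →ₐ[ℤ_[p]] L :=
    { ψ₀ with
      commutes' := fun z => by
        change ψ₀ _ = _
        rw [IsScalarTower.algebraMap_apply ℤ_[p] S A, hψ₀]
        change algebraMap B L (Ideal.Quotient.mk Q (algebraMap S _ (algebraMap ℤ_[p] S z))) = _
        rw [← IsScalarTower.algebraMap_apply ℤ_[p] S, IsScalarTower.algebraMap_apply ℤ_[p] B L]
        rfl }
  let m := RingHom.ker ψ
  let ψ' : A ⧸ m →ₐ[ℤ_[p]] L := Ideal.kerLiftAlg ψ
  have hψ' : Function.Injective ψ' := Ideal.kerLiftAlg_injective ψ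
  have hmprime : m.IsPrime := RingHom.ker_isPrime ψ
  have hint : Algebra.IsIntegral ℚ_[p] (A ⧸ m) := h.isIntegral_quotient m fun t => by
    rw [← isIntegral_algHom_iff ψ' hψ']
    change IsIntegral ℤ_[p] (ψ₀ (algebraMap S A t))
    rw [hψ₀]
    exact hBint _
  have hmax : m.IsMaximal := Ideal.Quotient.maximal_of_isField _
    (isField_of_isIntegral_of_isField' (Field.toIsField ℚ_[p]))
  let yL : L := algebraMap B L (Ideal.Quotient.mk Q Y)
  have hgy : ψ g * yL = 1 := by
    have h1 : Ideal.Quotient.mk Q v = 0 := Ideal.Quotient.eq_zero_iff_mem.2 hvQ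
    have h2 := congrArg (algebraMap B L) h1
    rw [hv, map_sub, map_sub, map_mul, map_mul, map_zero, sub_eq_zero] at h2
    have h3 : φ s = (p : L) ^ k * ψ g := by
      rw [← hψ₀, ← hs, map_mul, map_pow, map_natCast]; rfl
    have h4 : φ s * yL = (p : L) ^ k := by
      refine h2.trans ?_
      change φ ((p : S) ^ k) = _
      rw [map_pow, map_natCast]
    rw [h3, mul_assoc] at h4
    exact mul_left_cancel₀ (pow_ne_zero k hpL) (h4.trans (mul_one _).symm)
  refine ⟨m, hmax, ?_⟩
  have hg : Ideal.Quotient.mk m g ≠ 0 := by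
    intro h0
    have : ψ g = 0 := by
      change ψ' (Ideal.Quotient.mk m g) = 0
      rw [h0, map_zero]
    rw [this, zero_mul] at hgy
    exact zero_ne_one hgy
  obtain ⟨y, hy⟩ := Ideal.Quotient.exists_inv hg
  refine ⟨y, ?_, hy⟩
  rw [← isIntegral_algHom_iff ψ' hψ']
  have : ψ' y = yL := by
    have h1 : ψ g * ψ' y = 1 := by
      have := congrArg ψ' hy
      rwa [map_mul, map_one] at this
    have hg' : ψ g ≠ 0 := left_ne_zero_of_mul_eq_one hgy
    exact mul_left_cancel₀ hg' (h1.trans hgy.symm)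
  rw [this]
  exact hBint _

/-- The hypothesis says that the locus |g| ≥ 1 is empty. Hence gY - 1 generates the unit ideal after
inverting p in S⟨Y⟩, and the coefficients of its inverse are essentially the powers of g. -/
theorem IsModel.exists_pow_mem (h : IsModel p S A) {g : A}
    (hg : ∀ m : Ideal A, m.IsMaximal → ∀ y : A ⧸ m, IsIntegral ℤ_[p] y →
      Ideal.Quotient.mk m g * y ≠ 1) :
    ∃ j ≥ 1, g ^ j ∈ (algebraMap S A).range := by
  obtain ⟨k, s, hs⟩ := h.exists_pow g
  by_contra hcon
  obtain ⟨m, hm, y, hy, hgy⟩ := h.exists_maximal_of_not_dvd hs fun N hN =>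
    hcon (exists_pow_mem_of_dvd hs hN)
  exact hg m hm y hy hgy

end Model

/-! ### The integral closure of a reduced model is bounded -/

section Bounded

/-- The kernels of the powers of π form an ascending chain, which stabilizes. -/
theorem exists_pow_smul_eq_zero_of_isNoetherian {S M : Type*} [CommRing S] [AddCommGroup M]
    [Module S M] [IsNoetherian S M] (π : S) :
    ∃ C : ℕ, ∀ x : M, (∃ k : ℕ, π ^ k • x = 0) → π ^ C • x = 0 := by
  obtain ⟨C, hC⟩ := (LinearMap.eventually_iSup_ker_pow_eq
    (algebraMap S (Module.End S M) π)).exists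
  refine ⟨C, fun x ⟨k, hk⟩ => ?_⟩
  have hpow : ∀ (n : ℕ) (z : M), (algebraMap S (Module.End S M) π ^ n) z = π ^ n • z := by
    intro n z
    rw [← map_pow, Module.algebraMap_end_apply]
  have h1 : x ∈ ⨆ m, LinearMap.ker (algebraMap S (Module.End S M) π ^ m) :=
    Submodule.mem_iSup_of_mem k (by rw [LinearMap.mem_ker, hpow, hk])
  rw [hC, LinearMap.mem_ker, hpow] at h1
  exact h1

variable {p : ℕ} [Fact p.Prime]

/-- Noether normalization makes B finite over a normal Noetherian domain R of characteristic zero.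
The extension of fraction fields is then finite separable, so the integral closure of R in it is
finite, and it is also the integral closure of B. -/
theorem IsTopFinite.finite_integralClosure {B : Type*} [CommRing B] [IsDomain B] [Algebra ℤ_[p] B]
    (h : IsTopFinite p B) (hp : (p : B) ≠ 0) :
    Module.Finite B (integralClosure B (FractionRing B)) := by
  obtain ⟨d, f, hinj, hfin⟩ := h.exists_noether (mem_nonZeroDivisors_of_ne_zero hp)
    h.complete.not_isUnit
  let R : Type _ := RestrictedSeries (p : ℤ_[p]) (Fin d)
  have : IsIntegrallyClosed R := RestrictedSeries.isIntegrallyClosed_padicInt (Fin d)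
  have : IsNoetherianRing R := RestrictedSeries.isNoetherianRing_padicInt (Fin d)
  have : IsDomain R := RestrictedSeries.isDomain_padicInt (Fin d)
  let : Algebra R B := f.toRingHom.toAlgebra
  have : Module.Finite R B := hfin
  let L := FractionRing B
  let K := FractionRing R
  have hRL : Function.Injective (algebraMap R L) := by
    rw [IsScalarTower.algebraMap_eq R B L]
    exact (IsFractionRing.injective B L).comp hinj
  have : FaithfulSMul R L := (faithfulSMul_iff_algebraMap_injective R L).2 hRL
  have : FaithfulSMul R B := (faithfulSMul_iff_algebraMap_injective R B).2 hinj
  let : Algebra K L := FractionRing.liftAlgebra R L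
  have : CharZero R := by
    refine ⟨fun a b hab => ?_⟩
    have h1 : algebraMap ℤ_[p] R a = algebraMap ℤ_[p] R b := by simpa using hab
    have h2 := congrArg (RestrictedSeries.coeff 0) h1
    change MvPowerSeries.coeff 0 (algebraMap ℤ_[p] (MvPowerSeries (Fin d) ℤ_[p]) _)
      = MvPowerSeries.coeff 0 (algebraMap ℤ_[p] (MvPowerSeries (Fin d) ℤ_[p]) _) at h2
    rw [MvPowerSeries.algebraMap_apply, MvPowerSeries.algebraMap_apply,
      MvPowerSeries.coeff_zero_C, MvPowerSeries.coeff_zero_C] at h2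
    simpa using h2
  have : CharZero K := charZero_of_injective_algebraMap (IsFractionRing.injective R K)
  have : FiniteDimensional K L := inferInstance
  have : IsIntegralClosure (integralClosure B L) R L := by
    refine ⟨Subtype.val_injective, fun {x} => ⟨fun hx => ?_, ?_⟩⟩
    · exact ⟨⟨x, hx.tower_top⟩, rfl⟩
    · rintro ⟨y, rfl⟩
      exact isIntegral_trans (R := R) (A := B) _ y.2
  have := IsIntegralClosure.finite R K L (integralClosure B L)
  exact Module.Finite.of_restrictScalars_finite R B (integralClosure B L)

variable {S A : Type*} [CommRing S] [CommRing A] [Algebra ℤ_[p] S]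
  [Algebra ℤ_[p] A] [Algebra ℚ_[p] A] [IsScalarTower ℤ_[p] ℚ_[p] A] [Algebra S A]
  [IsScalarTower ℤ_[p] S A]

/-- The elements of a reduced affinoid algebra that are integral over a model form a bounded
set. -/
theorem IsModel.exists_pow_mul_mem (h : IsModel p S A) [IsReduced A] :
    ∃ C : ℕ, ∀ g : A, IsIntegral S g → (p : A) ^ C * g ∈ (algebraMap S A).range := by
  have := h.topFinite.isNoetherianRing
  have : IsReduced S := isReduced_of_injective (algebraMap S A) h.injective
  have hloc := h.isLocalization
  have hfin : Finite (minimalPrimes S) := (minimalPrimes.finite_of_isNoetherianRing S).to_subtype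
  have hprime : ∀ q : minimalPrimes S, q.1.IsPrime := fun q => q.2.1.1
  have hpB : ∀ q : minimalPrimes S, (p : S ⧸ q.1) ≠ 0 := by
    intro q h0
    rw [← map_natCast (Ideal.Quotient.mk q.1), Ideal.Quotient.eq_zero_iff_mem] at h0
    exact Set.disjoint_left.1 (Ideal.disjoint_nonZeroDivisors_of_mem_minimalPrimes q.2) h0
      h.mem_nonZeroDivisors
  let N : minimalPrimes S → Type _ := fun q => integralClosure (S ⧸ q.1) (FractionRing (S ⧸ q.1))
  have hN : ∀ q, Module.Finite S (N q) := fun q => by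
    have := (h.topFinite.of_surjective (Ideal.Quotient.mkₐ ℤ_[p] q.1)
      Ideal.Quotient.mk_surjective).finite_integralClosure (hpB q)
    exact Module.Finite.trans (S ⧸ q.1) (N q)
  have hS : ∀ q : minimalPrimes S,
      IsUnit (algebraMap S (FractionRing (S ⧸ q.1)) (p : S)) := fun q => by
    rw [map_natCast]
    refine IsUnit.mk0 _ fun h0 => hpB q ?_
    exact IsFractionRing.injective (S ⧸ q.1) (FractionRing (S ⧸ q.1))
      (by rw [map_natCast, map_zero, h0])
  let ψ₀ : ∀ q : minimalPrimes S, A →+* FractionRing (S ⧸ q.1) := fun q =>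
    IsLocalization.Away.lift (p : S) (hS q)
  have hψ₀ : ∀ q t, ψ₀ q (algebraMap S A t) = algebraMap S _ t := fun q =>
    IsLocalization.Away.lift_eq (p : S) (hS q)
  let ψ : ∀ q : minimalPrimes S, A →ₐ[S] FractionRing (S ⧸ q.1) := fun q =>
    { ψ₀ q with commutes' := hψ₀ q }
  -- The product is finite over the Noetherian ring S, so the p-power torsion of the cokernel of ι
  -- has bounded exponent C. An integral g defines such a torsion class, because some p^k g lies in
  -- S.
  let ι : S →ₗ[S] (∀ q, N q) := LinearMap.pi fun q => Algebra.linearMap S (N q)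
  obtain ⟨C, hC⟩ := exists_pow_smul_eq_zero_of_isNoetherian
    (M := (∀ q, N q) ⧸ LinearMap.range ι) (p : S)
  refine ⟨C, fun g hg => ?_⟩
  obtain ⟨k, s, hs⟩ := h.exists_pow g
  let γ : ∀ q, N q := fun q => ⟨ψ q g, (hg.map (ψ q)).tower_top⟩
  have h1 : (p : S) ^ k • γ = ι s := by
    funext q
    refine Subtype.ext ?_
    change (p : S) ^ k • ψ q g = algebraMap S (FractionRing (S ⧸ q.1)) s
    rw [← (ψ q).commutes, ← hs, ← map_smul, Algebra.smul_def, map_pow, map_natCast]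
  have h2 : (p : S) ^ C • (LinearMap.range ι).mkQ γ = 0 := by
    refine hC _ ⟨k, ?_⟩
    rw [← map_smul, h1, Submodule.mkQ_apply, Submodule.Quotient.mk_eq_zero]
    exact ⟨s, rfl⟩
  rw [← map_smul, Submodule.mkQ_apply, Submodule.Quotient.mk_eq_zero] at h2
  obtain ⟨t, ht⟩ := h2
  refine ⟨t, ?_⟩
  obtain ⟨l, w, hw⟩ := h.exists_pow (algebraMap S A t - (p : A) ^ C * g)
  -- The difference of t and p^C g vanishes in every Frac(S/q). Cleared of denominators, it lies in
  -- all minimal primes of the reduced ring S.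
  have hw0 : w = 0 := by
    have hmem : w ∈ sInf (⊥ : Ideal S).minimalPrimes := by
      rw [Submodule.mem_sInf]
      intro q hq
      have h3 : ψ ⟨q, hq⟩ (algebraMap S A t - (p : A) ^ C * g) = 0 := by
        have h4 := congrArg Subtype.val (congrFun ht ⟨q, hq⟩)
        change algebraMap S (FractionRing (S ⧸ q)) t = (p : S) ^ C • ψ ⟨q, hq⟩ g at h4
        rw [map_sub, AlgHom.commutes, h4, map_mul, map_pow, map_natCast, Algebra.smul_def, map_pow,
          map_natCast, sub_self]
      have h5 : algebraMap S (FractionRing (S ⧸ q)) w = 0 := by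
        rw [← (ψ ⟨q, hq⟩).commutes, ← hw, map_mul, h3, mul_zero]
      rw [← Ideal.Quotient.eq_zero_iff_mem]
      have := hprime ⟨q, hq⟩
      refine IsFractionRing.injective (S ⧸ q) (FractionRing (S ⧸ q)) ?_
      rw [map_zero, ← h5]; rfl
    rw [Ideal.sInf_minimalPrimes] at hmem
    have : w ∈ nilradical S := hmem
    rwa [nilradical_eq_zero] at this
  rw [hw0, map_zero] at hw
  exact sub_eq_zero.1 (((isUnit_natCast_of_algebra (p := p)).pow l).mul_right_eq_zero.1 hw)

end Bounded

/-! ### Symmetrization of commuting matrices -/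

section Symmetrization

open scoped Kronecker

variable {p : ℕ} [Fact p.Prime]

theorem isUnit_two_padicInt (hp : p ≠ 2) : IsUnit (2 : ℤ_[p]) := by
  rw [PadicInt.isUnit_iff]
  by_contra h
  have h1 : ‖((2 : ℤ) : ℤ_[p])‖ < 1 := lt_of_le_of_ne (PadicInt.norm_le_one _) (by simpa using h)
  rw [PadicInt.norm_int_lt_one_iff_dvd] at h1
  exact hp ((Nat.prime_dvd_prime_iff_eq Fact.out Nat.prime_two).1 (by exact_mod_cast h1))

/-- -1 is a sum of two squares modulo p, and Hensel's lemma lifts a nonzero one of the two; this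
uses that 2 is a unit. -/
theorem exists_sq_add_sq_eq_neg_one (hp : p ≠ 2) : ∃ a b : ℤ_[p], a ^ 2 + b ^ 2 = -1 := by
  obtain ⟨a, b, hab⟩ := ZMod.sq_add_sq p (-1)
  wlog ha : a ≠ 0 generalizing a b
  · refine this b a (by rw [add_comm]; exact hab) fun hb => ?_
    rw [not_not.1 ha, hb] at hab
    simp at hab
  obtain ⟨a, rfl⟩ := ZMod.ringHom_surjective (PadicInt.toZMod (p := p)) a
  obtain ⟨b, rfl⟩ := ZMod.ringHom_surjective (PadicInt.toZMod (p := p)) b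
  have hlt : ∀ z : ℤ_[p], ‖z‖ < 1 ↔ PadicInt.toZMod z = 0 := by
    intro z
    rw [← PadicInt.mem_nonunits, ← IsLocalRing.mem_maximalIdeal, ← PadicInt.ker_toZMod,
      RingHom.mem_ker]
  let F : Polynomial ℤ_[p] := Polynomial.X ^ 2 + Polynomial.C (b ^ 2 + 1)
  have hF : ∀ z, F.aeval z = z ^ 2 + (b ^ 2 + 1) := fun z => by simp [F]
  have hF' : F.derivative.aeval a = 2 * a := by
    rw [Polynomial.derivative_add, Polynomial.derivative_C, add_zero]
    simp [one_add_one_eq_two]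
  have hunit : ‖F.derivative.aeval a‖ = 1 := by
    rw [hF', norm_mul, PadicInt.isUnit_iff.1 (isUnit_two_padicInt hp), one_mul]
    exact le_antisymm (PadicInt.norm_le_one a) (not_lt.1 fun h => ha ((hlt a).1 h))
  obtain ⟨z, hz, -⟩ := hensels_lemma (F := F) (a := a) (by
    rw [hunit, one_pow, hF, hlt]
    simp only [map_add, map_pow, map_one]
    rw [← add_assoc, hab]; ring)
  exact ⟨z, b, by rw [hF] at hz; linear_combination hz⟩

/-- There is an idempotent matrix `e` with `eᵀ = 1 - e`. -/
theorem exists_idempotent_transpose (hp : p ≠ 2) :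
    ∃ e : Matrix (Fin 4) (Fin 4) ℤ_[p], e * e = e ∧ e + e.transpose = 1 := by
  obtain ⟨a, b, hab⟩ := exists_sq_add_sq_eq_neg_one hp
  obtain ⟨c, hc⟩ := (isUnit_two_padicInt hp).exists_right_inv
  -- e = (1 + J)/2 with J = [[0, W], [-W, 0]] and W = [[a, b], [b, -a]]. W is symmetric with W² = a²
  -- + b² = -1, so Jᵀ = -J and J² = 1.
  refine ⟨c • !![1, 0, a, b; 0, 1, b, -a; -a, -b, 1, 0; -b, a, 0, 1], ?_, ?_⟩
  · have h1 : !![1, 0, a, b; 0, 1, b, -a; -a, -b, 1, 0; -b, a, 0, 1]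
        * !![1, 0, a, b; 0, 1, b, -a; -a, -b, 1, 0; -b, a, 0, 1]
        = (2 : ℤ_[p]) • !![1, 0, a, b; 0, 1, b, -a; -a, -b, 1, 0; -b, a, 0, 1] := by
      ext i j
      fin_cases i <;> fin_cases j <;>
        simp [Matrix.mul_apply, Fin.sum_univ_four] <;> first | ring1 | linear_combination -hab
    rw [Matrix.smul_mul, Matrix.mul_smul, h1, smul_smul, smul_smul]
    congr 1
    linear_combination c * hc
  · ext i j
    fin_cases i <;> fin_cases j <;> simp <;> linear_combination hc

variable {ι κ : Type*} [Fintype ι] [DecidableEq ι] [Fintype κ] [DecidableEq κ]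
  {e : Matrix κ κ ℤ_[p]}

/-- The symmetric matrix `T ⊗ e + Tᵀ ⊗ eᵀ`. -/
def symmetrize (e : Matrix κ κ ℤ_[p]) (T : Matrix ι ι ℤ_[p]) : Matrix (ι × κ) (ι × κ) ℤ_[p] :=
  T ⊗ₖ e + T.transpose ⊗ₖ e.transpose

theorem symmetrize_transpose (T : Matrix ι ι ℤ_[p]) :
    (symmetrize e T).transpose = symmetrize e T := by
  ext x y
  exact add_comm (T y.1 x.1 * e y.2 x.2) (T x.1 y.1 * e x.2 y.2)

theorem symmetrize_add (T U : Matrix ι ι ℤ_[p]) :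
    symmetrize e (T + U) = symmetrize e T + symmetrize e U := by
  simp only [symmetrize, Matrix.transpose_add, Matrix.add_kronecker]
  abel

theorem symmetrize_smul (c : ℤ_[p]) (T : Matrix ι ι ℤ_[p]) :
    symmetrize e (c • T) = c • symmetrize e T := by
  simp only [symmetrize, Matrix.transpose_smul, Matrix.smul_kronecker, smul_add]

theorem mul_transpose_eq_zero (he : e * e = e) (he' : e + e.transpose = 1) :
    e * e.transpose = 0 ∧ e.transpose * e = 0 := by
  have h : e.transpose = 1 - e := eq_sub_of_add_eq' he'
  rw [h, mul_sub, sub_mul, mul_one, one_mul, he, sub_self]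
  exact ⟨rfl, rfl⟩

/-- The cross terms vanish because e and eᵀ are orthogonal idempotents. Commutation is needed
because TᵀUᵀ is the transpose of UT. -/
theorem symmetrize_mul (he : e * e = e) (he' : e + e.transpose = 1) {T U : Matrix ι ι ℤ_[p]}
    (h : T * U = U * T) : symmetrize e (T * U) = symmetrize e T * symmetrize e U := by
  obtain ⟨h1, h2⟩ := mul_transpose_eq_zero he he'
  simp only [symmetrize, add_mul, mul_add]
  rw [← Matrix.mul_kronecker_mul, ← Matrix.mul_kronecker_mul, ← Matrix.mul_kronecker_mul,
    ← Matrix.mul_kronecker_mul, h1, h2, he, ← Matrix.transpose_mul, ← Matrix.transpose_mul, he,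
    Matrix.kronecker_zero, Matrix.kronecker_zero, ← h]
  simp

theorem dvd_symmetrize {c : ℤ_[p]} {T : Matrix ι ι ℤ_[p]} (h : ∀ i j, c ∣ T i j) (x y) :
    c ∣ symmetrize e T x y := by
  change c ∣ T x.1 y.1 * e x.2 y.2 + T y.1 x.1 * e y.2 x.2
  exact dvd_add ((h _ _).mul_right _) ((h _ _).mul_right _)

/-- Multiplication by 1 ⊗ e recovers T ⊗ e, and the diagonal entries of e equal 1/2, a unit. -/
theorem dvd_of_dvd_symmetrize [Nonempty κ] (he : e * e = e)
    (he' : e + e.transpose = 1) {c : ℤ_[p]} {T : Matrix ι ι ℤ_[p]}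
    (h : ∀ x y, c ∣ symmetrize e T x y) (i j) : c ∣ T i j := by
  obtain ⟨k⟩ := ‹Nonempty κ›
  obtain ⟨h1, h2⟩ := mul_transpose_eq_zero he he'
  have h3 : symmetrize e T * ((1 : Matrix ι ι ℤ_[p]) ⊗ₖ e) = T ⊗ₖ e := by
    rw [symmetrize, add_mul, ← Matrix.mul_kronecker_mul, ← Matrix.mul_kronecker_mul, he, h2,
      Matrix.kronecker_zero, add_zero, mul_one]
  have h4 : c ∣ T i j * e k k := by
    have : (T ⊗ₖ e) (i, k) (j, k) = T i j * e k k := rfl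
    rw [← this, ← h3, Matrix.mul_apply]
    exact Finset.dvd_sum fun z _ => (h _ _).mul_right _
  have h5 : e k k * 2 = 1 := by
    have := congrFun (congrFun he' k) k
    rw [Matrix.add_apply, Matrix.transpose_apply, Matrix.one_apply_eq] at this
    rw [mul_two, this]
  exact (h4.mul_right 2).trans (by rw [mul_assoc, h5, mul_one])

end Symmetrization

/-! ### Block diagonal operators -/

section BlockOperators

variable {p : ℕ} [Fact p.Prime] {I : Type u} {ι : I → Type} [∀ i, Fintype (ι i)]
  [TopologicalSpace (Σ i, ι i)] [DiscreteTopology (Σ i, ι i)]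

theorem norm_apply_le {X : Type*} [TopologicalSpace X] (ξ : C₀(X, ℤ_[p])) (x : X) :
    ‖ξ x‖ ≤ ‖ξ‖ := by
  rw [← ZeroAtInftyContinuousMap.norm_toBCF_eq_norm]
  exact ξ.toBCF.norm_coe_le_norm x

theorem norm_le_of_forall {X : Type*} [TopologicalSpace X] (ξ : C₀(X, ℤ_[p])) {c : ℝ}
    (hc : 0 ≤ c) (h : ∀ x, ‖ξ x‖ ≤ c) : ‖ξ‖ ≤ c := by
  rw [← ZeroAtInftyContinuousMap.norm_toBCF_eq_norm, BoundedContinuousFunction.norm_le hc]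
  exact h

theorem norm_sum_mul_le {κ : Type*} [Fintype κ] (f g : κ → ℤ_[p]) {c d : ℝ} (hc : 0 ≤ c)
    (hd : 0 ≤ d) (hf : ∀ j, ‖f j‖ ≤ c) (hg : ∀ j, ‖g j‖ ≤ d) : ‖∑ j, f j * g j‖ ≤ c * d := by
  refine IsUltrametricDist.norm_sum_le_of_forall_le_of_nonneg (mul_nonneg hc hd) fun j _ => ?_
  rw [norm_mul]
  exact mul_le_mul (hf j) (hg j) (norm_nonneg _) hc

/-- The block diagonal operator with the blocks `M i`, as a linear map. -/
def blockEnd (M : ∀ i, Matrix (ι i) (ι i) ℤ_[p]) : Module.End ℤ_[p] (C0 p (Σ i, ι i)) where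
  toFun ξ :=
    { toFun := fun x => ∑ j, M x.1 x.2 j * ξ ⟨x.1, j⟩
      continuous_toFun := continuous_of_discreteTopology
      zero_at_infty' := by
        have hξ := ξ.zero_at_infty'
        rw [cocompact_eq_cofinite] at hξ ⊢
        rw [Metric.tendsto_nhds] at hξ ⊢
        intro ε hε
        have hfin := hξ (ε / 2) (half_pos hε)
        rw [Filter.eventually_cofinite] at hfin ⊢
        have hfib : ∀ i, (Sigma.fst ⁻¹' {i} : Set (Σ i, ι i)).Finite := fun i =>
          (Set.finite_range (Sigma.mk i)).subset (by rintro ⟨_, j⟩ rfl; exact ⟨j, rfl⟩)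
        refine ((Set.Finite.image Sigma.fst hfin).preimage' (f := Sigma.fst)
          fun i _ => hfib i).subset fun x hx => ?_
        by_contra hcon
        refine hx ?_
        rw [dist_zero_right]
        refine lt_of_le_of_lt (norm_sum_mul_le (M x.1 x.2) _ zero_le_one (half_pos hε).le
          (fun j => PadicInt.norm_le_one _) fun j => ?_) (by linarith)
        by_contra hj
        refine hcon ⟨⟨x.1, j⟩, ?_, rfl⟩
        intro hlt
        rw [dist_zero_right] at hlt
        exact hj hlt.le }
  map_add' ξ η := by
    ext x
    change ∑ j, M x.1 x.2 j * (ξ _ + η _) = ∑ j, _ + ∑ j, _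
    simp only [mul_add, Finset.sum_add_distrib]
  map_smul' c ξ := by
    ext x
    change ∑ j, M x.1 x.2 j * (c * ξ _) = c * ∑ j, _
    rw [Finset.mul_sum]
    exact Finset.sum_congr rfl fun j _ => mul_left_comm _ _ _

theorem blockEnd_apply (M : ∀ i, Matrix (ι i) (ι i) ℤ_[p]) (ξ : C0 p (Σ i, ι i))
    (x : Σ i, ι i) : blockEnd M ξ x = ∑ j, M x.1 x.2 j * ξ ⟨x.1, j⟩ := rfl

theorem norm_blockEnd_le (M : ∀ i, Matrix (ι i) (ι i) ℤ_[p]) {c : ℝ} (hc : 0 ≤ c)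
    (hM : ∀ i j k, ‖M i j k‖ ≤ c) (ξ : C0 p (Σ i, ι i)) : ‖blockEnd M ξ‖ ≤ c * ‖ξ‖ := by
  refine norm_le_of_forall _ (mul_nonneg hc (norm_nonneg _)) fun x => ?_
  rw [blockEnd_apply]
  exact norm_sum_mul_le _ _ hc (norm_nonneg _) (hM _ _) fun j => norm_apply_le ξ _

theorem isBdd_blockEnd (M : ∀ i, Matrix (ι i) (ι i) ℤ_[p]) : IsBdd (blockEnd M) :=
  ⟨1, norm_blockEnd_le M zero_le_one fun _ _ _ => PadicInt.norm_le_one _⟩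

theorem isAdj_blockEnd (M : ∀ i, Matrix (ι i) (ι i) ℤ_[p]) :
    IsAdj (blockEnd M) (blockEnd fun i => (M i).transpose) := by
  intro ξ η
  rw [pairing, pairing, (summable_pairing ξ (blockEnd M η)).tsum_sigma' fun i => Summable.of_finite,
    (summable_pairing (blockEnd _ ξ) η).tsum_sigma' fun i => Summable.of_finite]
  refine tsum_congr fun i => ?_
  rw [tsum_fintype, tsum_fintype]
  change ∑ j, ξ ⟨i, j⟩ * ∑ k, M i j k * η ⟨i, k⟩ = ∑ k, (∑ j, M i j k * ξ ⟨i, j⟩) * η ⟨i, k⟩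
  simp only [Finset.mul_sum, Finset.sum_mul]
  rw [Finset.sum_comm]
  exact Finset.sum_congr rfl fun j _ => Finset.sum_congr rfl fun k _ => by ring

/-- The block diagonal operator with the blocks `M i`. -/
def blockOp (M : ∀ i, Matrix (ι i) (ι i) ℤ_[p]) : AdjOp p (Σ i, ι i) :=
  ⟨blockEnd M, isBdd_blockEnd M, _, isBdd_blockEnd _, isAdj_blockEnd M⟩

theorem blockOp_add (M N : ∀ i, Matrix (ι i) (ι i) ℤ_[p]) :
    blockOp (M + N) = blockOp M + blockOp N := by
  refine Subtype.ext (LinearMap.ext fun ξ => ZeroAtInftyContinuousMap.ext fun x => ?_)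
  change ∑ j, (M x.1 x.2 j + N x.1 x.2 j) * ξ _ = ∑ j, _ + ∑ j, _
  simp only [add_mul, Finset.sum_add_distrib]

theorem blockOp_smul (c : ℤ_[p]) (M : ∀ i, Matrix (ι i) (ι i) ℤ_[p]) :
    blockOp (c • M) = c • blockOp M := by
  refine Subtype.ext (LinearMap.ext fun ξ => ZeroAtInftyContinuousMap.ext fun x => ?_)
  change ∑ j, (c * M x.1 x.2 j) * ξ _ = c * ∑ j, _
  rw [Finset.mul_sum]
  exact Finset.sum_congr rfl fun j _ => mul_assoc _ _ _

theorem blockOp_mul (M N : ∀ i, Matrix (ι i) (ι i) ℤ_[p]) :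
    blockOp (fun i => M i * N i) = blockOp M * blockOp N := by
  refine Subtype.ext (LinearMap.ext fun ξ => ZeroAtInftyContinuousMap.ext fun x => ?_)
  change ∑ j, (M x.1 * N x.1) x.2 j * ξ _ = ∑ j, M x.1 x.2 j * ∑ k, N x.1 j k * ξ _
  simp only [Matrix.mul_apply, Finset.sum_mul, Finset.mul_sum]
  rw [Finset.sum_comm]
  exact Finset.sum_congr rfl fun j _ => Finset.sum_congr rfl fun k _ => mul_assoc _ _ _

theorem star_blockOp {M : ∀ i, Matrix (ι i) (ι i) ℤ_[p]} (h : ∀ i, (M i).transpose = M i) :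
    star (blockOp M) = blockOp M := by
  refine eq_adj ?_
  have := isAdj_blockEnd M
  rwa [funext h] at this

/-- The norm is the largest absolute value of an entry: the ultrametric inequality bounds it above,
and a vector `delta` picks out a given entry. -/
theorem opNorm_blockOp {M : ∀ i, Matrix (ι i) (ι i) ℤ_[p]} {c : ℝ} (hc : 0 ≤ c)
    (hM : ∀ i j k, ‖M i j k‖ ≤ c) (h : c = 0 ∨ ∃ i j k, c ≤ ‖M i j k‖) :
    opNorm (blockOp M) = c := by
  classical
  have hub : ∀ r ∈ {r : ℝ | ∃ ξ : C0 p (Σ i, ι i), ‖ξ‖ ≤ 1 ∧ r = ‖(blockOp M).1 ξ‖}, r ≤ c := by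
    rintro r ⟨ξ, hξ, rfl⟩
    exact (norm_blockEnd_le M hc hM ξ).trans (mul_le_of_le_one_right hc hξ)
  refine le_antisymm (Real.sSup_le hub hc) ?_
  rcases h with rfl | ⟨i, j, k, hijk⟩
  · refine Real.sSup_nonneg ?_
    rintro r ⟨ξ, -, rfl⟩
    exact norm_nonneg _
  · refine hijk.trans ((?_ : ‖M i j k‖ ≤ ‖(blockOp M).1 (delta ⟨i, k⟩)‖).trans
      (le_csSup ⟨c, hub⟩ ⟨delta ⟨i, k⟩, ?_, rfl⟩))
    · have h1 : blockEnd M (delta ⟨i, k⟩) ⟨i, j⟩ = M i j k := by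
        rw [blockEnd_apply, Finset.sum_eq_single k]
        · have : (delta ⟨i, k⟩ : C0 p (Σ i, ι i)) ⟨i, k⟩ = 1 := Pi.single_eq_same _ _
          rw [this, mul_one]
        · intro l _ hl
          have : (delta ⟨i, k⟩ : C0 p (Σ i, ι i)) ⟨i, l⟩ = 0 :=
            Pi.single_eq_of_ne (by simpa using hl) _
          rw [this, mul_zero]
        · simp
      rw [← h1]
      exact norm_apply_le _ _
    · refine norm_le_of_forall _ zero_le_one fun x => PadicInt.norm_le_one _

end BlockOperators

/-! ### Representations of commutative algebras -/

section Representation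

variable {p : ℕ} [Fact p.Prime]

/-- Applying the matrix of x to the coordinates of 1 gives the coordinates of x. -/
theorem pow_dvd_leftMulMatrix_iff {O κ : Type*} [CommRing O] [Algebra ℤ_[p] O] [Fintype κ]
    [DecidableEq κ] (b : Module.Basis κ ℤ_[p] O) (c : ℤ_[p]) (x : O) :
    (∀ i j, c ∣ Algebra.leftMulMatrix b x i j) ↔ ∃ y, x = c • y := by
  constructor
  · intro h
    have h1 : ∀ i, c ∣ b.repr x i := by
      intro i
      have := congrFun (Algebra.leftMulMatrix_mulVec_repr b x 1) i
      rw [mul_one] at this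
      rw [← this]
      exact Finset.dvd_sum fun j _ => (h i j).mul_right _
    choose d hd using h1
    refine ⟨∑ i, d i • b i, ?_⟩
    rw [Finset.smul_sum]
    conv_lhs => rw [← b.sum_repr x]
    exact Finset.sum_congr rfl fun i _ => by rw [hd, smul_smul]
  · rintro ⟨y, rfl⟩ i j
    rw [map_smul]
    exact dvd_mul_right _ _

/-- A commutative algebra whose norm is detected by homomorphisms into finite free `ℤ_p`-algebras
has an isometric `*`-representation. -/
theorem exists_rep_of_detected (hp : p ≠ 2) {B : Type u} [CommRing B] [Algebra ℤ_[p] B] {I : Type u}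
    {O : I → Type*} [∀ i, CommRing (O i)] [∀ i, Algebra ℤ_[p] (O i)]
    [∀ i, Module.Finite ℤ_[p] (O i)] [∀ i, Module.Free ℤ_[p] (O i)]
    (φ : ∀ i, B →ₐ[ℤ_[p]] O i) (ν : B → ℝ)
    (hν : ∀ b, ν b = 0 ∨ ∃ k : ℕ, ν b = (p : ℝ) ^ (-k : ℤ))
    (hdvd : ∀ b (k : ℕ), ν b ≤ (p : ℝ) ^ (-k : ℤ) ↔ ∀ i, ∃ y, φ i b = (p : ℤ_[p]) ^ k • y) :
    letI : StarRing B := starRingOfComm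
    ∃ (X : Type u) (_ : TopologicalSpace X) (_ : DiscreteTopology X)
      (π : B →⋆ₙₐ[ℤ_[p]] AdjOp p X), ∀ b, opNorm (π b) = ν b := by
  let : StarRing B := starRingOfComm
  obtain ⟨e, he, he'⟩ := exists_idempotent_transpose hp
  let bas := fun i => Module.finBasis ℤ_[p] (O i)
  let M : B → ∀ i, Matrix (Fin (Module.finrank ℤ_[p] (O i)) × Fin 4)
      (Fin (Module.finrank ℤ_[p] (O i)) × Fin 4) ℤ_[p] :=
    fun b i => symmetrize e (Algebra.leftMulMatrix (bas i) (φ i b))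
  let X : Type u := Σ i, Fin (Module.finrank ℤ_[p] (O i)) × Fin 4
  let : TopologicalSpace X := ⊥
  have : DiscreteTopology X := ⟨rfl⟩
  have hMadd : ∀ b c, M (b + c) = M b + M c := fun b c => funext fun i => by
    change symmetrize e _ = symmetrize e _ + symmetrize e _
    rw [map_add, map_add, symmetrize_add]
  have hMsmul : ∀ (z : ℤ_[p]) b, M (z • b) = z • M b := fun z b => funext fun i => by
    change symmetrize e _ = z • symmetrize e _
    rw [map_smul, map_smul, symmetrize_smul]
  have hMmul : ∀ b c, M (b * c) = fun i => M b i * M c i := fun b c => funext fun i => by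
    change symmetrize e _ = symmetrize e _ * symmetrize e _
    rw [map_mul, map_mul]
    refine symmetrize_mul he he' ?_
    simp only [← map_mul, mul_comm b c]
  let π : B →⋆ₙₐ[ℤ_[p]] AdjOp p X :=
    { toFun := fun b => blockOp (M b)
      map_smul' := fun z b => (congrArg blockOp (hMsmul z b)).trans (blockOp_smul z _)
      map_zero' := by
        have h := (congrArg blockOp (hMsmul 0 0)).trans (blockOp_smul 0 _)
        rwa [zero_smul, zero_smul] at h
      map_add' := fun b c => (congrArg blockOp (hMadd b c)).trans (blockOp_add _ _)
      map_mul' := fun b c => (congrArg blockOp (hMmul b c)).trans (blockOp_mul _ _)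
      map_star' := fun b => (star_blockOp fun i => symmetrize_transpose _).symm }
  refine ⟨X, inferInstance, inferInstance, π, fun b => ?_⟩
  have hp1 : (1 : ℝ) < p := by exact_mod_cast (Fact.out : p.Prime).one_lt
  have key : ∀ k : ℕ, ν b ≤ (p : ℝ) ^ (-k : ℤ) ↔ ∀ i x y, ‖M b i x y‖ ≤ (p : ℝ) ^ (-k : ℤ) := by
    intro k
    rw [hdvd]
    refine forall_congr' fun i => ?_
    rw [← pow_dvd_leftMulMatrix_iff (bas i)]
    simp only [PadicInt.norm_le_pow_iff_mem_span_pow, Ideal.mem_span_singleton]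
    exact ⟨fun h => dvd_symmetrize h, fun h => dvd_of_dvd_symmetrize he he' h⟩
  refine opNorm_blockOp ?_ ?_ ?_
  · rcases hν b with h | ⟨k, h⟩ <;> rw [h]
    positivity
  · rcases hν b with h | ⟨k, h⟩
    · intro i x y
      have h1 : ∀ k : ℕ, ‖M b i x y‖ ≤ (p : ℝ) ^ (-k : ℤ) := fun k =>
        (key k).1 (by rw [h]; positivity) i x y
      rw [h]
      refine ge_of_tendsto' (tendsto_pow_atTop_nhds_zero_of_lt_one (r := (p : ℝ)⁻¹) (by positivity)
        (inv_lt_one_of_one_lt₀ hp1)) fun k => ?_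
      have := h1 k
      rwa [zpow_neg, zpow_natCast, ← inv_pow] at this
    · intro i x y
      rw [h]
      exact (key k).1 h.le i x y
  · rcases hν b with h | ⟨k, h⟩
    · exact Or.inl h
    · right
      by_contra! hcon
      -- If every entry were smaller than ν b = p^(-k), then by discreteness all would be at most
      -- p^(-k-1), and `key` would give the same bound for ν b.
      have h2 : ν b ≤ (p : ℝ) ^ (-(k + 1 : ℕ) : ℤ) := by
        rw [key]
        intro i x y
        have h3 := hcon i x y
        rw [h] at h3
        rw [PadicInt.norm_le_pow_iff_norm_lt_pow_add_one]
        convert! h3 using 2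
        push_cast; ring
      rw [h] at h2
      have := (zpow_le_zpow_iff_right₀ hp1).1 h2
      push_cast at this
      linarith

end Representation

/-! ### Norms defined by lattices -/

section Lattice

variable {p : ℕ} [Fact p.Prime]

theorem one_lt_prime_real : (1 : ℝ) < p := by exact_mod_cast (Fact.out : p.Prime).one_lt

theorem prime_ne_zero_padic : (p : ℚ_[p]) ≠ 0 := by
  exact_mod_cast (Fact.out : p.Prime).ne_zero

variable {A : Type*} [CommRing A] [Algebra ℤ_[p] A] [Algebra ℚ_[p] A] [IsScalarTower ℤ_[p] ℚ_[p] A]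

/-- The values of `ν` are zero or powers of `p`, and the balls of `ν` are the multiples of `B`. -/
structure IsLatticeNorm (B : Submodule ℤ_[p] A) (ν : A → ℝ) : Prop where
  values : ∀ a, ν a = 0 ∨ ∃ k : ℤ, ν a = (p : ℝ) ^ k
  le_iff : ∀ (a : A) (k : ℤ), ν a ≤ (p : ℝ) ^ k ↔ (p : ℚ_[p]) ^ k • a ∈ B

theorem zpow_smul_smul (k : ℤ) (a : A) (n : ℕ) :
    (p : ℚ_[p]) ^ k • (p : ℤ_[p]) ^ n • a = (p : ℚ_[p]) ^ (k + n) • a := by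
  rw [← algebraMap_smul ℚ_[p] ((p : ℤ_[p]) ^ n) a, smul_smul, map_pow, map_natCast,
    zpow_add₀ prime_ne_zero_padic, zpow_natCast]

theorem prime_pow_mul_eq_smul (n : ℕ) (a : A) : (p : A) ^ n * a = (p : ℚ_[p]) ^ n • a := by
  rw [Algebra.smul_def, map_pow, map_natCast]

namespace IsLatticeNorm

variable {B : Submodule ℤ_[p] A} {ν : A → ℝ}

theorem nonneg (h : IsLatticeNorm B ν) (a : A) : 0 ≤ ν a := by
  rcases h.values a with h | ⟨k, h⟩ <;> rw [h]
  positivity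

theorem le_one_iff (h : IsLatticeNorm B ν) (a : A) : ν a ≤ 1 ↔ a ∈ B := by
  have := h.le_iff a 0
  rwa [zpow_zero, zpow_zero, one_smul] at this

theorem le_zpow_of_lt (h : IsLatticeNorm B ν) {a : A} {k : ℤ} (hlt : ν a < (p : ℝ) ^ (k + 1)) :
    ν a ≤ (p : ℝ) ^ k := by
  rcases h.values a with h | ⟨l, h⟩
  · rw [h]; positivity
  · rw [h] at hlt ⊢
    have := (zpow_lt_zpow_iff_right₀ one_lt_prime_real).1 hlt
    exact (zpow_le_zpow_iff_right₀ one_lt_prime_real).2 (by omega)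

/-- Two numbers that are zero or powers of p agree once they lie below the same powers of p. -/
theorem eq_of_le_iff (h : IsLatticeNorm B ν) {a : A} {x : ℝ}
    (hx : x = 0 ∨ ∃ k : ℤ, x = (p : ℝ) ^ k)
    (hax : ∀ k : ℤ, (p : ℚ_[p]) ^ k • a ∈ B ↔ x ≤ (p : ℝ) ^ k) : ν a = x := by
  have hp1 := one_lt_prime_real (p := p)
  have h0 : ∀ {y z : ℝ}, (y = 0 ∨ ∃ k : ℤ, y = (p : ℝ) ^ k) → 0 ≤ z →
      (∀ k : ℤ, y ≤ (p : ℝ) ^ k → z ≤ (p : ℝ) ^ k) → z ≤ y := by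
    rintro y z (rfl | ⟨k, rfl⟩) hz hyz
    · refine ge_of_tendsto' (tendsto_pow_atTop_nhds_zero_of_lt_one (r := (p : ℝ)⁻¹)
        (by positivity) (inv_lt_one_of_one_lt₀ hp1)) fun k => ?_
      have := hyz (-k) (by positivity)
      rwa [zpow_neg, zpow_natCast, ← inv_pow] at this
    · exact hyz k le_rfl
  have hx0 : 0 ≤ x := by rcases hx with rfl | ⟨k, rfl⟩ <;> positivity
  exact le_antisymm (h0 hx (h.nonneg a) fun k hk => (h.le_iff a k).2 ((hax k).2 hk))
    (h0 (h.values a) hx0 fun k hk => (hax k).1 ((h.le_iff a k).1 hk))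

theorem map_zero (h : IsLatticeNorm B ν) : ν 0 = 0 :=
  h.eq_of_le_iff (Or.inl rfl) fun k => by
    rw [smul_zero]
    exact iff_of_true B.zero_mem (by positivity)

theorem map_smul (h : IsLatticeNorm B ν) (c : ℤ_[p]) (a : A) : ν (c • a) = ‖c‖ * ν a := by
  by_cases hc : c = 0
  · rw [hc, zero_smul, h.map_zero, norm_zero, zero_mul]
  have hnorm : ‖c‖ = (p : ℝ) ^ (-c.valuation : ℤ) := PadicInt.norm_eq_zpow_neg_valuation hc
  have hp0 : (p : ℝ) ≠ 0 := (zero_lt_one.trans one_lt_prime_real).ne'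
  refine h.eq_of_le_iff ?_ fun k => ?_
  · rcases h.values a with h | ⟨l, h⟩
    · left; rw [h, mul_zero]
    · right; exact ⟨-c.valuation + l, by rw [h, hnorm, zpow_add₀ hp0]⟩
  · have h1 : ‖c‖ * ν a ≤ (p : ℝ) ^ k ↔ ν a ≤ (p : ℝ) ^ (k + c.valuation) := by
      have hpos : (0 : ℝ) < (p : ℝ) ^ (c.valuation : ℤ) :=
        zpow_pos (zero_lt_one.trans one_lt_prime_real) _
      rw [hnorm, zpow_neg, inv_mul_le_iff₀ hpos, zpow_add₀ hp0, mul_comm]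
    rw [h1, h.le_iff, ← zpow_smul_smul]
    obtain ⟨u, hu⟩ : ∃ u : ℤ_[p]ˣ, c = u * (p : ℤ_[p]) ^ c.valuation :=
      ⟨PadicInt.unitCoeff hc, PadicInt.unitCoeff_spec hc⟩
    conv_lhs => rw [hu, mul_smul, smul_comm]
    constructor
    · intro hm
      have := B.smul_mem (↑u⁻¹ : ℤ_[p]) hm
      rwa [smul_smul, Units.inv_mul, one_smul] at this
    · exact fun hm => B.smul_mem _ hm

/-- The quotient norm of a lattice norm is the norm of the image of the lattice. -/
theorem quotNorm (h : IsLatticeNorm B ν) (J : Ideal A) :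
    IsLatticeNorm (B.map (Ideal.Quotient.mkₐ ℤ_[p] J).toLinearMap)
      (PadicOpAlg.quotNorm ν J) := by
  have hp1 := one_lt_prime_real (p := p)
  have hbdd : ∀ a, BddBelow {r : ℝ | ∃ F : A, Ideal.Quotient.mk J F = a ∧ r = ν F} := by
    rintro a
    refine ⟨0, ?_⟩
    rintro r ⟨F, -, rfl⟩
    exact h.nonneg F
  have hne : ∀ a, {r : ℝ | ∃ F : A, Ideal.Quotient.mk J F = a ∧ r = ν F}.Nonempty := by
    intro a
    obtain ⟨F, rfl⟩ := Ideal.Quotient.mk_surjective a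
    exact ⟨_, F, rfl, rfl⟩
  -- Discreteness of the values replaces an infimum below p^(k+1) by a representative of norm at
  -- most p^k, so approximate lifts become exact ones.
  have hlt : ∀ (a : A ⧸ J) (k : ℤ), PadicOpAlg.quotNorm ν J a < (p : ℝ) ^ (k + 1) →
      ∃ F, Ideal.Quotient.mk J F = a ∧ ν F ≤ (p : ℝ) ^ k := by
    intro a k hk
    obtain ⟨r, ⟨F, hF, rfl⟩, hr⟩ := exists_lt_of_csInf_lt (hne a) hk
    exact ⟨F, hF, h.le_zpow_of_lt hr⟩
  have hle : ∀ (a : A ⧸ J) (k : ℤ), PadicOpAlg.quotNorm ν J a ≤ (p : ℝ) ^ k ↔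
      ∃ F, Ideal.Quotient.mk J F = a ∧ ν F ≤ (p : ℝ) ^ k := by
    refine fun a k => ⟨fun hk => hlt a k (hk.trans_lt ?_), ?_⟩
    · exact (zpow_lt_zpow_iff_right₀ hp1).2 (by omega)
    · rintro ⟨F, hF, hk⟩
      exact (csInf_le (hbdd a) ⟨F, hF, rfl⟩).trans hk
  refine ⟨fun a => ?_, fun a k => ?_⟩
  · have hnn : 0 ≤ PadicOpAlg.quotNorm ν J a := le_csInf (hne a) (by
      rintro r ⟨F, -, rfl⟩; exact h.nonneg F)
    rcases hnn.eq_or_lt with h0 | h0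
    · exact Or.inl h0.symm
    · obtain ⟨k, hk1, hk2⟩ := exists_mem_Ico_zpow h0 hp1
      exact Or.inr ⟨k, le_antisymm ((hle a k).2 (hlt a k hk2)) hk1⟩
  · rw [hle]
    constructor
    · rintro ⟨F, rfl, hF⟩
      exact ⟨_, (h.le_iff F k).1 hF, rfl⟩
    · rintro ⟨b, hb, hba⟩
      refine ⟨(p : ℚ_[p]) ^ (-k) • b, ?_, ?_⟩
      · change (Ideal.Quotient.mkₐ ℚ_[p] J) _ = a
        rw [_root_.map_smul]
        change (p : ℚ_[p]) ^ (-k) • (Ideal.Quotient.mkₐ ℤ_[p] J).toLinearMap b = a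
        rw [hba, smul_smul, ← zpow_add₀ prime_ne_zero_padic, neg_add_cancel, zpow_zero, one_smul]
      · rw [h.le_iff, smul_smul, ← zpow_add₀ prime_ne_zero_padic, add_neg_cancel, zpow_zero,
          one_smul]
        exact hb

/-- The supremum of lattice norms is attained. -/
theorem exists_eq_iSup {I : Type*} [Nonempty I] {B : I → Submodule ℤ_[p] A} {ν : I → A → ℝ}
    (h : ∀ i, IsLatticeNorm (B i) (ν i)) {a : A} (hb : BddAbove (Set.range fun i => ν i a)) :
    ∃ i, ν i a = ⨆ i, ν i a := by
  have hp1 := one_lt_prime_real (p := p)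
  have hnn : 0 ≤ ⨆ i, ν i a := Real.iSup_nonneg fun i => (h i).nonneg a
  rcases hnn.eq_or_lt with h0 | h0
  · obtain ⟨i⟩ := ‹Nonempty I›
    exact ⟨i, le_antisymm (le_ciSup hb i) (h0 ▸ (h i).nonneg a)⟩
  -- With p^k < sup ≤ p^(k+1), any member above p^k already has value at least p^(k+1).
  · obtain ⟨k, hk1, hk2⟩ := exists_mem_Ioc_zpow h0 hp1
    obtain ⟨i, hi⟩ := exists_lt_of_lt_ciSup hk1
    refine ⟨i, le_antisymm (le_ciSup hb i) (hk2.trans ?_)⟩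
    by_contra hcon
    exact hi.not_ge ((h i).le_zpow_of_lt (not_le.1 hcon))

theorem iSup {I : Type*} {B : I → Submodule ℤ_[p] A} {ν : I → A → ℝ}
    (h : ∀ i, IsLatticeNorm (B i) (ν i)) (hb : ∀ a, BddAbove (Set.range fun i => ν i a)) :
    IsLatticeNorm (⨅ i, B i) (fun a => ⨆ i, ν i a) where
  values a := by
    -- The empty family occurs for A = 0; the real supremum is then 0 by convention.
    rcases isEmpty_or_nonempty I with hI | hI
    · exact Or.inl (Real.iSup_of_isEmpty _)
    · obtain ⟨i, hi⟩ := exists_eq_iSup h (hb a)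
      rw [← hi]
      exact (h i).values a
  le_iff a k := by
    rw [Submodule.mem_iInf]
    constructor
    · exact fun hk i => ((h i).le_iff a k).1 ((le_ciSup (hb a) i).trans hk)
    · exact fun hk => Real.iSup_le (fun i => ((h i).le_iff a k).2 (hk i))
        (by positivity)

theorem comap {A' : Type*} [CommRing A'] [Algebra ℤ_[p] A'] [Algebra ℚ_[p] A']
    [IsScalarTower ℤ_[p] ℚ_[p] A'] (h : IsLatticeNorm B ν) (f : A' →ₗ[ℚ_[p]] A) :
    IsLatticeNorm (B.comap (f.restrictScalars ℤ_[p])) (fun a => ν (f a)) where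
  values a := h.values (f a)
  le_iff a k := by
    rw [h.le_iff, ← _root_.map_smul]; rfl

end IsLatticeNorm

theorem isLatticeNorm_padic :
    IsLatticeNorm (LinearMap.range (Algebra.linearMap ℤ_[p] ℚ_[p])) (fun a : ℚ_[p] => ‖a‖) where
  values a := by
    rcases eq_or_ne a 0 with rfl | ha
    · exact Or.inl norm_zero
    · exact Or.inr ⟨_, Padic.norm_eq_zpow_neg_valuation ha⟩
  le_iff a k := by
    have h1 : ∀ x : ℚ_[p], x ∈ LinearMap.range (Algebra.linearMap ℤ_[p] ℚ_[p]) ↔ ‖x‖ ≤ 1 :=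
      fun x => ⟨by rintro ⟨y, rfl⟩; exact y.2, fun hx => ⟨⟨x, hx⟩, rfl⟩⟩
    have hpos : (0 : ℝ) < (p : ℝ) ^ k := zpow_pos (zero_lt_one.trans one_lt_prime_real) _
    rw [h1, smul_eq_mul, norm_mul, norm_zpow, Padic.norm_p, inv_zpow, inv_mul_le_iff₀ hpos,
      mul_one]

end Lattice

/-! ### Unit balls as operator algebras -/

section UnitBall

variable {p : ℕ} [Fact p.Prime]

/-- Such a z is the image of 1/p, which is not integral because `ℤ_p` is integrally closed. -/
theorem not_isIntegral_of_prime_mul_eq_one {L : Type*} [CommRing L] [Nontrivial L]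
    [Algebra ℤ_[p] L] [Algebra ℚ_[p] L] [IsScalarTower ℤ_[p] ℚ_[p] L] {z : L}
    (hz : (p : L) * z = 1) : ¬ IsIntegral ℤ_[p] z := by
  intro hint
  have h1 : z = algebraMap ℚ_[p] L (p : ℚ_[p])⁻¹ := by
    have h2 : algebraMap ℚ_[p] L (p : ℚ_[p])⁻¹ * (p : L) = 1 := by
      rw [← map_natCast (algebraMap ℚ_[p] L), ← map_mul, inv_mul_cancel₀ prime_ne_zero_padic,
        map_one]
    rw [← one_mul z, ← h2, mul_assoc, hz, mul_one]
  rw [h1] at hint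
  have h3 : IsIntegral ℤ_[p] (p : ℚ_[p])⁻¹ :=
    (isIntegral_algHom_iff (IsScalarTower.toAlgHom ℤ_[p] ℚ_[p] L)
      (algebraMap ℚ_[p] L).injective).1 hint
  obtain ⟨y, hy⟩ := IsIntegrallyClosed.isIntegral_iff.1 h3
  have h4 : ‖(y : ℚ_[p])‖ ≤ 1 := y.2
  have h5 : (y : ℚ_[p]) = (p : ℚ_[p])⁻¹ := hy
  rw [h5, norm_inv, Padic.norm_p, inv_inv] at h4
  exact h4.not_gt one_lt_prime_real

variable {A : Type u} [CommRing A] [Algebra ℤ_[p] A] [Algebra ℚ_[p] A] [IsScalarTower ℤ_[p] ℚ_[p] A]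
  {S B : Subalgebra ℤ_[p] A} {O : ∀ m : MaximalSpectrum A, Subalgebra ℤ_[p] (A ⧸ m.asIdeal)}
  [hO : ∀ m, Module.Finite ℤ_[p] (O m)]

/-- The elements of a reduced affinoid algebra whose values at all points are integral form a
bounded set. -/
theorem IsModel.exists_pow_mul_mem_of_forall_mem (hS : IsModel p S A) [IsReduced A]
    (hB : ∀ a, a ∈ B ↔ ∀ m : MaximalSpectrum A, Ideal.Quotient.mk m.asIdeal a ∈ O m) :
    ∃ C : ℕ, ∀ b ∈ B, (p : A) ^ C * b ∈ S := by
  obtain ⟨C, hC⟩ := hS.exists_pow_mul_mem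
  refine ⟨C + 1, fun b hb => ?_⟩
  -- If y were an integral inverse of pb at some point, then by, a product of integral elements,
  -- would be an inverse of p. So a power of pb lies in S. The extra factor p accounts for the
  -- exponent C + 1.
  have hint : IsIntegral S ((p : A) * b) := by
    obtain ⟨j, hj, hmem⟩ := hS.exists_pow_mem (g := (p : A) * b) fun m hm y hy hgy => by
      have hbm : IsIntegral ℤ_[p] (Ideal.Quotient.mk m b) :=
        (Algebra.IsIntegral.isIntegral (R := ℤ_[p])
          (⟨_, (hB b).1 hb ⟨m, hm⟩⟩ : O ⟨m, hm⟩)).map (O ⟨m, hm⟩).val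
      have := Ideal.Quotient.nontrivial_iff.2 hm.ne_top
      refine not_isIntegral_of_prime_mul_eq_one (p := p) ?_ (hbm.mul hy)
      rwa [map_mul, map_natCast, mul_assoc] at hgy
    obtain ⟨s, hs⟩ := hmem
    refine IsIntegral.of_pow hj ?_
    rw [← hs]
    exact isIntegral_algebraMap
  obtain ⟨s, hs⟩ := hC _ hint
  rw [pow_succ, mul_assoc, ← hs]
  exact s.2

theorem IsModel.eq_zero_of_forall (hS : IsModel p S A) {C : ℕ}
    (hC : ∀ b ∈ B, (p : A) ^ C * b ∈ S) {a : A}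
    (ha : ∀ k : ℕ, (p : ℚ_[p]) ^ (-k : ℤ) • a ∈ B) : a = 0 := by
  have hu : IsUnit (p : A) := isUnit_natCast_of_algebra
  have h0 := hC _ (ha 0)
  have hz : (p : ℚ_[p]) ^ (-(0 : ℕ) : ℤ) • a = a := by simp
  rw [hz] at h0
  have h1 : (⟨(p : A) ^ C * a, h0⟩ : S) = 0 := by
    refine hS.topFinite.complete.haus _ fun k => ⟨⟨_, hC _ (ha k)⟩, Subtype.ext ?_⟩
    change (p : A) ^ C * a = ((p : S) ^ k : S) * ((p : A) ^ C * _)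
    have h2 : (p : A) ^ k * ((p : ℚ_[p]) ^ (-k : ℤ) • a) = a := by
      rw [prime_pow_mul_eq_smul (p := p), smul_smul, zpow_neg, zpow_natCast,
        mul_inv_cancel₀ (pow_ne_zero k prime_ne_zero_padic), one_smul]
    rw [mul_left_comm]
    rw [SubmonoidClass.coe_pow, SubringClass.coe_natCast, h2]
  exact (hu.pow C).mul_right_eq_zero.1 (congrArg Subtype.val h1)

/-- Since p^C B ⊆ S ⊆ B, the increments of a Cauchy sequence in B, multiplied by p^C, can be summed
in the complete ring S. -/
theorem IsModel.exists_limit (hS : IsModel p S A) (hSB : S ≤ B) {C : ℕ}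
    (hC : ∀ b ∈ B, (p : A) ^ C * b ∈ S) {ν : A → ℝ}
    (hν : IsLatticeNorm (Subalgebra.toSubmodule B) ν) (a : ℕ → B)
    (ha : ∀ ε > 0, ∃ N, ∀ k ≥ N, ∀ l ≥ N, ν (a k - a l : A) < ε) :
    ∃ b : B, Tendsto (fun k => ν (a k - b : A)) atTop (𝓝 0) := by
  have hp1 := one_lt_prime_real (p := p)
  have hu : IsUnit (p : A) := isUnit_natCast_of_algebra
  have hle : ∀ (x : A) (n : ℕ), ν x ≤ (p : ℝ) ^ (-n : ℤ) ↔ ∃ y ∈ B, x = (p : A) ^ n * y := by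
    intro x n
    rw [hν.le_iff]
    constructor
    · intro h
      refine ⟨_, h, ?_⟩
      rw [prime_pow_mul_eq_smul (p := p), smul_smul, zpow_neg, zpow_natCast,
        mul_inv_cancel₀ (pow_ne_zero n prime_ne_zero_padic), one_smul]
    · rintro ⟨y, hy, rfl⟩
      rw [prime_pow_mul_eq_smul (p := p), smul_smul, zpow_neg, zpow_natCast,
        inv_mul_cancel₀ (pow_ne_zero n prime_ne_zero_padic), one_smul]
      exact hy
  have hN : ∀ n : ℕ, ∃ N, ∀ k ≥ N, ∀ l ≥ N, ν (a k - a l : A) ≤ (p : ℝ) ^ (-n : ℤ) := by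
    intro n
    obtain ⟨N, hN⟩ := ha ((p : ℝ) ^ (-n : ℤ)) (by positivity)
    exact ⟨N, fun k hk l hl => (hN k hk l hl).le⟩
  choose N₀ hN₀ using hN
  -- A monotone majorant of the Cauchy thresholds `N₀`.
  let N : ℕ → ℕ := fun n => ∑ i ∈ Finset.range (n + 1), N₀ i
  have hN₀N : ∀ n, N₀ n ≤ N n := fun n =>
    Finset.single_le_sum (f := N₀) (fun _ _ => Nat.zero_le _) (Finset.self_mem_range_succ n)
  have hNmono : ∀ n, N n ≤ N (n + 1) := fun n => by
    simp only [N]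
    rw [Finset.sum_range_succ _ (n + 1)]
    exact Nat.le_add_right _ _
  have hstep : ∀ n, ∃ y ∈ B, (a (N (n + 1)) - a (N n) : A) = (p : A) ^ n * y := fun n =>
    (hle _ _).1 (hN₀ n _ ((hN₀N n).trans (hNmono n)) _ (hN₀N n))
  choose y hyB hy using hstep
  obtain ⟨L, hL⟩ := hS.topFinite.complete.prec fun n => ⟨_, hC _ (hyB n)⟩
  have hsum : ∀ n, ((∑ i ∈ Finset.range n, (p : S) ^ i * ⟨_, hC _ (hyB i)⟩ : S) : A)
      = (p : A) ^ C * (a (N n) - a (N 0)) := by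
    intro n
    rw [← Finset.sum_range_sub (fun n => (a (N n) : A)) n, Finset.mul_sum]
    simp only [AddSubmonoidClass.coe_finsetSum, Subalgebra.coe_mul, Subalgebra.coe_pow,
      SubringClass.coe_natCast, hy]
    exact Finset.sum_congr rfl fun i _ => mul_left_comm _ _ _
  obtain ⟨l, hl⟩ : ∃ l : A, (p : A) ^ C * l = L := by
    obtain ⟨v, hv⟩ := (hu.pow C).exists_right_inv
    exact ⟨v * L, by rw [← mul_assoc, hv, one_mul]⟩
  have hlim : ∀ n, ∃ t ∈ S, (p : A) ^ C * (l + a (N 0) - a (N n)) = (p : A) ^ n * t := by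
    intro n
    obtain ⟨t, ht⟩ := hL n
    refine ⟨t, t.2, ?_⟩
    have h1 := congrArg Subtype.val ht
    rw [Subalgebra.coe_sub, hsum, ← hl] at h1
    calc (p : A) ^ C * (l + a (N 0) - a (N n))
        = (p : A) ^ C * l - (p : A) ^ C * (a (N n) - a (N 0)) := by ring
      _ = _ := h1.trans (by simp)
  -- At index C the approximation error p^C t absorbs the denominator, so the limit differs from `a
  -- (N C)` by an element of S.
  have hlB : l + a (N 0) ∈ B := by
    obtain ⟨t, ht, h1⟩ := hlim C
    have h2 := (hu.pow C).mul_left_cancel h1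
    rw [sub_eq_iff_eq_add.1 h2]
    exact B.add_mem (hSB ht) (a (N C)).2
  refine ⟨⟨_, hlB⟩, ?_⟩
  have hconv : ∀ n k, N (n + C) ≤ k → ν (a k - (l + a (N 0)) : A) ≤ (p : ℝ) ^ (-n : ℤ) := by
    intro n k hk
    obtain ⟨t, ht, h1⟩ := hlim (n + C)
    obtain ⟨z, hz, h2⟩ := (hle _ _).1
      (hN₀ (n + C) k ((hN₀N _).trans hk) (N (n + C)) (hN₀N _))
    rw [hle]
    refine ⟨(p : A) ^ C * z - t,
      B.sub_mem (B.mul_mem (B.pow_mem (by simp) C) hz) (hSB ht), ?_⟩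
    have h3 : l + a (N 0) - a (N (n + C)) = (p : A) ^ n * t := by
      refine (hu.pow C).mul_left_cancel ?_
      rw [h1, pow_add]; ring
    calc (a k - (l + a (N 0)) : A)
        = (a k - a (N (n + C))) - (l + a (N 0) - a (N (n + C))) := by ring
      _ = _ := by rw [h2, h3, pow_add]; ring
  rw [Metric.tendsto_atTop]
  intro ε hε
  obtain ⟨n, hn⟩ := exists_pow_lt_of_lt_one hε (inv_lt_one_of_one_lt₀ hp1)
  refine ⟨N (n + C), fun k hk => ?_⟩
  rw [Real.dist_0_eq_abs, abs_of_nonneg (hν.nonneg _)]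
  refine (hconv n k hk).trans_lt ?_
  rwa [zpow_neg, zpow_natCast, ← inv_pow]

/-- The common core of (1) and (2), which differ only in the choice of the finite algebras O_𝔪.
Submultiplicativity holds because B is a ring, and the O_𝔪 are free because they are torsion-free
over `ℤ_p`. -/
theorem IsModel.unitBallIsPadicOperatorAlgebra (hp : p ≠ 2) (hS : IsModel p S A) [IsReduced A]
    (hSO : ∀ m, ∀ s ∈ S, Ideal.Quotient.mk m.asIdeal s ∈ O m)
    (hB : ∀ a, a ∈ B ↔ ∀ m : MaximalSpectrum A, Ideal.Quotient.mk m.asIdeal a ∈ O m)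
    {ν : A → ℝ} (hν : IsLatticeNorm (Subalgebra.toSubmodule B) ν) :
    UnitBallIsPadicOperatorAlgebra p ν := by
  have hp1 := one_lt_prime_real (p := p)
  obtain ⟨C, hC⟩ := hS.exists_pow_mul_mem_of_forall_mem hB
  have hSB : S ≤ B := fun s hs => (hB s).2 fun m => hSO m s hs
  have hzero : ∀ a, ν a = 0 ↔ a = 0 := by
    refine fun a => ⟨fun ha => hS.eq_zero_of_forall hC fun k => ?_, fun ha => ha ▸ hν.map_zero⟩
    exact (hν.le_iff a _).1 (by rw [ha]; positivity)
  have hmul : ∀ a b, ν (a * b) ≤ ν a * ν b := by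
    intro a b
    rcases hν.values a with ha | ⟨k, hk⟩
    · rw [(hzero a).1 ha, zero_mul, hν.map_zero, zero_mul]
    rcases hν.values b with hb | ⟨l, hl⟩
    · rw [(hzero b).1 hb, mul_zero, hν.map_zero, mul_zero]
    rw [hk, hl, ← zpow_add₀ (zero_lt_one.trans hp1).ne', hν.le_iff,
      zpow_add₀ prime_ne_zero_padic, ← smul_mul_smul_comm]
    exact B.mul_mem ((hν.le_iff a k).1 hk.le) ((hν.le_iff b l).1 hl.le)
  have hadd : ∀ a b, ν (a + b) ≤ max (ν a) (ν b) := by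
    intro a b
    have hle : ∀ k : ℤ, ν a ≤ (p : ℝ) ^ k → ν b ≤ (p : ℝ) ^ k → ν (a + b) ≤ (p : ℝ) ^ k := by
      intro k ha hb
      rw [hν.le_iff, smul_add]
      exact B.add_mem ((hν.le_iff a k).1 ha) ((hν.le_iff b k).1 hb)
    rcases hν.values a with ha | ⟨k, hk⟩
    · rw [(hzero a).1 ha, zero_add]; exact le_max_right _ _
    rcases hν.values b with hb | ⟨l, hl⟩
    · rw [(hzero b).1 hb, add_zero]; exact le_max_left _ _
    rcases le_total (ν a) (ν b) with h | h
    · refine le_max_of_le_right ?_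
      rw [hl] at h ⊢
      exact hle l h hl.le
    · refine le_max_of_le_left ?_
      rw [hk] at h ⊢
      exact hle k hk.le h
  have hfree : ∀ m, Module.Free ℤ_[p] (O m) := by
    intro m
    have := m.isMaximal
    have := Ideal.Quotient.nontrivial_iff.2 m.isMaximal.ne_top
    have hinj : Function.Injective (algebraMap ℤ_[p] (A ⧸ m.asIdeal)) := by
      rw [IsScalarTower.algebraMap_eq ℤ_[p] ℚ_[p]]
      exact (algebraMap ℚ_[p] (A ⧸ m.asIdeal)).injective.comp
        (IsFractionRing.injective ℤ_[p] ℚ_[p])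
    have : Module.IsTorsionFree ℤ_[p] (O m) := by
      have : FaithfulSMul ℤ_[p] (O m) := by
        rw [faithfulSMul_iff_algebraMap_injective]
        exact fun x y hxy => hinj (congrArg Subtype.val hxy)
      infer_instance
    infer_instance
  refine ⟨B, fun f => (hν.le_one_iff f).symm, ?_⟩
  let : StarRing B := starRingOfComm
  refine ⟨⟨fun a => hν.nonneg _, fun a => ?_, fun a b => hadd _ _, fun c a => hν.map_smul c a,
    fun a b => hmul _ _, fun a => rfl, fun a ha => hS.exists_limit hSB hC hν a ha⟩, ?_⟩
  · rw [hzero]; exact ZeroMemClass.coe_eq_zero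
  · let φ : ∀ m, B →ₐ[ℤ_[p]] O m := fun m =>
      ((Ideal.Quotient.mkₐ ℤ_[p] m.asIdeal).comp B.val).codRestrict (O m) fun b => (hB b).1 b.2 m
    refine exists_rep_of_detected hp φ (fun b : B => ν b) (fun b => ?_) fun b k => ?_
    · rcases hν.values b with h | ⟨k, hk⟩
      · exact Or.inl h
      · right
        have h1 : ν b ≤ 1 := (hν.le_one_iff _).2 b.2
        rw [hk] at h1
        have h2 : k ≤ 0 := by
          rw [← zpow_zero (p : ℝ)] at h1
          exact (zpow_le_zpow_iff_right₀ hp1).1 h1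
        exact ⟨k.natAbs, by rw [hk]; congr 1; omega⟩
    · rw [hν.le_iff]
      change (p : ℚ_[p]) ^ (-k : ℤ) • (b : A) ∈ B ↔ _
      rw [hB]
      refine forall_congr' fun m => ?_
      have hsm : Ideal.Quotient.mk m.asIdeal ((p : ℚ_[p]) ^ (-k : ℤ) • (b : A))
          = (p : ℚ_[p]) ^ (-k : ℤ) • Ideal.Quotient.mk m.asIdeal b :=
        map_smul (Ideal.Quotient.mkₐ ℚ_[p] m.asIdeal) _ _
      rw [hsm]
      constructor
      · intro h
        refine ⟨⟨_, h⟩, Subtype.ext ?_⟩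
        change Ideal.Quotient.mk m.asIdeal b = (p : ℤ_[p]) ^ k • _
        rw [smul_comm, zpow_smul_smul, neg_add_cancel, zpow_zero, one_smul]
      · rintro ⟨y, hy⟩
        have h1 : Ideal.Quotient.mk m.asIdeal b = (p : ℤ_[p]) ^ k • (y : A ⧸ m.asIdeal) :=
          congrArg Subtype.val hy
        rw [h1, zpow_smul_smul, neg_add_cancel, zpow_zero, one_smul]
        exact y.2

end UnitBall

/-! ### The integral model of an affinoid algebra -/

section Tate

variable {p : ℕ} [Fact p.Prime] {n : ℕ}

theorem padicInt_pow_dvd_iff (x : ℤ_[p]) (k : ℕ) : (p : ℤ_[p]) ^ k ∣ x ↔ ‖x‖ ≤ (p : ℝ) ^ (-k : ℤ) := by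
  rw [PadicInt.norm_le_pow_iff_mem_span_pow, Ideal.mem_span_singleton]

theorem isRestricted_one_iff {R : Type*} [NormedRing R] {σ : Type*} (F : MvPowerSeries σ R) :
    MvPowerSeries.IsRestricted (fun _ : σ => (1 : ℝ)) F ↔
      Tendsto (fun t => ‖MvPowerSeries.coeff t F‖) cofinite (𝓝 0) := by
  simp [MvPowerSeries.IsRestricted, Finsupp.prod]

theorem mem_tateAlgebra_iff (F : MvPowerSeries (Fin n) ℚ_[p]) :
    F ∈ TateAlgebra p n ↔ Tendsto (fun t => ‖MvPowerSeries.coeff t F‖) cofinite (𝓝 0) :=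
  isRestricted_one_iff F

theorem mem_restrictedSeries_iff {σ : Type*} (F : MvPowerSeries σ ℤ_[p]) :
    F ∈ RestrictedSeries (p : ℤ_[p]) σ ↔
      Tendsto (fun t => ‖MvPowerSeries.coeff t F‖) cofinite (𝓝 0) := by
  have hp1 := one_lt_prime_real (p := p)
  change (∀ k : ℕ, {m | ¬ (p : ℤ_[p]) ^ k ∣ MvPowerSeries.coeff m F}.Finite) ↔ _
  simp only [padicInt_pow_dvd_iff]
  rw [Metric.tendsto_nhds]
  constructor
  · intro h ε hε
    obtain ⟨k, hk⟩ := exists_pow_lt_of_lt_one hε (inv_lt_one_of_one_lt₀ hp1)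
    refine eventually_cofinite.2 ((h k).subset fun m hm hle => hm ?_)
    rw [Real.dist_0_eq_abs, abs_norm]
    refine hle.trans_lt ?_
    rwa [zpow_neg, zpow_natCast, ← inv_pow]
  · intro h k
    refine (eventually_cofinite.1 (h ((p : ℝ) ^ (-k : ℤ)) (by positivity))).subset fun m hm hlt => hm ?_
    rw [Real.dist_0_eq_abs, abs_norm] at hlt
    exact hlt.le

variable (p n) in
/-- The inclusion `ℤ_p⟨x₁, …, xₙ⟩ → ℚ_p⟨x₁, …, xₙ⟩`. -/
def toTate : RestrictedSeries (p : ℤ_[p]) (Fin n) →ₐ[ℤ_[p]] TateAlgebra p n where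
  toFun F := ⟨MvPowerSeries.map (algebraMap ℤ_[p] ℚ_[p]) F.1, by
    rw [mem_tateAlgebra_iff]
    exact (mem_restrictedSeries_iff F.1).1 F.2⟩
  map_one' := Subtype.ext (map_one _)
  map_mul' F G := Subtype.ext (map_mul _ _ _)
  map_zero' := Subtype.ext (map_zero _)
  map_add' F G := Subtype.ext (map_add _ _ _)
  commutes' c := Subtype.ext (MvPowerSeries.ext fun t => by
    classical
    change algebraMap ℤ_[p] ℚ_[p] (MvPowerSeries.coeff t (algebraMap ℤ_[p] _ c)) =
      MvPowerSeries.coeff t (algebraMap ℤ_[p] (MvPowerSeries (Fin n) ℚ_[p]) c)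
    rw [MvPowerSeries.algebraMap_apply, MvPowerSeries.algebraMap_apply, MvPowerSeries.coeff_C,
      MvPowerSeries.coeff_C, apply_ite (algebraMap ℤ_[p] ℚ_[p]), map_zero]
    rfl)

/-- The coefficient of a monomial. -/
def tateCoeff (t : Fin n →₀ ℕ) : TateAlgebra p n →ₗ[ℚ_[p]] ℚ_[p] :=
  (MvPowerSeries.coeff t).comp (TateAlgebra p n).val.toLinearMap

theorem mem_range_toTate_iff (F : TateAlgebra p n) :
    F ∈ (toTate p n).range ↔ ∀ t, ‖tateCoeff t F‖ ≤ 1 := by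
  constructor
  · rintro ⟨G, rfl⟩ t
    exact (MvPowerSeries.coeff t G.1).2
  · intro h
    let G : MvPowerSeries (Fin n) ℤ_[p] := fun t => ⟨tateCoeff t F, h t⟩
    refine ⟨⟨G, ?_⟩, Subtype.ext (MvPowerSeries.ext fun t => rfl)⟩
    rw [mem_restrictedSeries_iff]
    exact (mem_tateAlgebra_iff F.1).1 F.2

theorem bddAbove_tateCoeff (F : TateAlgebra p n) :
    BddAbove (Set.range fun t => ‖tateCoeff t F‖) := by
  have h := (mem_tateAlgebra_iff F.1).1 F.2
  have h1 := (h.eventually (gt_mem_nhds one_pos))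
  rw [eventually_cofinite] at h1
  refine ((h1.image fun t => ‖tateCoeff t F‖).bddAbove.union (bddAbove_Iic (a := (1 : ℝ)))).mono ?_
  rintro _ ⟨t, rfl⟩
  by_cases ht : ‖tateCoeff t F‖ < 1
  · exact Or.inr ht.le
  · exact Or.inl ⟨t, ht, rfl⟩

theorem gaussNorm_eq_iSup (F : TateAlgebra p n) : gaussNorm F = ⨆ t, ‖tateCoeff t F‖ := by
  rw [gaussNorm, MvPowerSeries.gaussNorm]
  simp [Finsupp.prod]
  rfl

/-- The Gauss norm is a supremum of pullbacks of the p-adic absolute value along the coefficient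
maps. -/
theorem isLatticeNorm_gaussNorm :
    IsLatticeNorm (Subalgebra.toSubmodule (toTate p n).range) (gaussNorm (p := p) (n := n)) := by
  have h := IsLatticeNorm.iSup (fun t => isLatticeNorm_padic.comap (tateCoeff (p := p) (n := n) t))
    bddAbove_tateCoeff
  have h1 : (fun F => ⨆ t, ‖tateCoeff t F‖) = gaussNorm (p := p) (n := n) :=
    funext fun F => (gaussNorm_eq_iSup F).symm
  rw [h1] at h
  convert h using 1
  ext F
  rw [Subalgebra.mem_toSubmodule, mem_range_toTate_iff, Submodule.mem_iInf]
  exact forall_congr' fun t => (isLatticeNorm_padic.le_one_iff (tateCoeff t F))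

variable (I : Ideal (TateAlgebra p n))

/-- The map from `ℤ_p⟨x₁, …, xₙ⟩` to an affinoid algebra. -/
def toAffinoid : RestrictedSeries (p : ℤ_[p]) (Fin n) →ₐ[ℤ_[p]] AffinoidAlgebra I :=
  (Ideal.Quotient.mkₐ ℤ_[p] I).comp (toTate p n)

theorem isLatticeNorm_residueNorm :
    IsLatticeNorm (Subalgebra.toSubmodule (toAffinoid I).range) (residueNorm I) := by
  have h := (isLatticeNorm_gaussNorm (p := p) (n := n)).quotNorm I
  have h1 : Submodule.map (Ideal.Quotient.mkₐ ℤ_[p] I).toLinearMap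
      (Subalgebra.toSubmodule (toTate p n).range) = Subalgebra.toSubmodule (toAffinoid I).range := by
    ext a
    constructor
    · rintro ⟨_, ⟨F, rfl⟩, rfl⟩
      exact ⟨F, rfl⟩
    · rintro ⟨F, rfl⟩
      exact ⟨_, ⟨F, rfl⟩, rfl⟩
  rw [h1] at h
  exact h

end Tate

/-! ### Norms at the maximal ideals, and the two unit balls -/

section Points

variable {p : ℕ} [Fact p.Prime] {A : Type u} [CommRing A] [Algebra ℤ_[p] A] [Algebra ℚ_[p] A]
  [IsScalarTower ℤ_[p] ℚ_[p] A] {S : Subalgebra ℤ_[p] A} {ρ : A → ℝ}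

theorem IsLatticeNorm.classNorm (hρ : IsLatticeNorm (Subalgebra.toSubmodule S) ρ)
    (m : MaximalSpectrum A) :
    IsLatticeNorm (Subalgebra.toSubmodule
      ((S.map (Ideal.Quotient.mkₐ ℤ_[p] m.asIdeal)).comap (Ideal.Quotient.mkₐ ℤ_[p] m.asIdeal)))
      (classNorm ρ m) :=
  (hρ.quotNorm m.asIdeal).comap (Ideal.Quotient.mkₐ ℚ_[p] m.asIdeal).toLinearMap

theorem IsLatticeNorm.classNorm_le (hρ : IsLatticeNorm (Subalgebra.toSubmodule S) ρ)
    (m : MaximalSpectrum A) {f : A} {k : ℤ} (h : ρ f ≤ (p : ℝ) ^ k) :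
    PadicOpAlg.classNorm ρ m f ≤ (p : ℝ) ^ k :=
  ((hρ.classNorm m).le_iff f k).2 ⟨_, (hρ.le_iff f k).1 h, rfl⟩

theorem IsLatticeNorm.bddAbove_classNorm (hρ : IsLatticeNorm (Subalgebra.toSubmodule S) ρ) (f : A) :
    BddAbove (Set.range fun m => PadicOpAlg.classNorm ρ m f) := by
  obtain ⟨k, hk⟩ := pow_unbounded_of_one_lt (ρ f) (one_lt_prime_real (p := p))
  refine ⟨(p : ℝ) ^ (k : ℤ), ?_⟩
  rintro _ ⟨m, rfl⟩
  exact hρ.classNorm_le m (by exact_mod_cast hk.le)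

theorem IsLatticeNorm.isGreatest_maxNorm [Nontrivial A]
    (hρ : IsLatticeNorm (Subalgebra.toSubmodule S) ρ) (f : A) :
    IsGreatest (Set.range fun m => PadicOpAlg.classNorm ρ m f) (maxNorm ρ f) := by
  have hne : Nonempty (MaximalSpectrum A) := inferInstance
  exact ⟨IsLatticeNorm.exists_eq_iSup (fun m => hρ.classNorm m) (hρ.bddAbove_classNorm f), by
    rintro _ ⟨m, rfl⟩
    exact le_ciSup (hρ.bddAbove_classNorm f) m⟩

theorem IsModel.finite_map (hS : IsModel p S A) (m : MaximalSpectrum A) :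
    Module.Finite ℤ_[p] (S.map (Ideal.Quotient.mkₐ ℤ_[p] m.asIdeal)) := by
  have := m.isMaximal
  have h : S.map (Ideal.Quotient.mkₐ ℤ_[p] m.asIdeal) =
      (IsScalarTower.toAlgHom ℤ_[p] S (A ⧸ m.asIdeal)).range := by
    ext x
    constructor
    · rintro ⟨s, hs, rfl⟩
      exact ⟨⟨s, hs⟩, rfl⟩
    · rintro ⟨s, rfl⟩
      exact ⟨s, s.2, rfl⟩
  rw [h]
  exact hS.finite_range m.asIdeal

/-- Here O_𝔪 is the image of S, which is the unit ball of the quotient norm on A/𝔪. -/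
theorem IsModel.unitBall_maxNorm (hp : p ≠ 2) (hS : IsModel p S A) [IsReduced A]
    (hρ : IsLatticeNorm (Subalgebra.toSubmodule S) ρ) :
    UnitBallIsPadicOperatorAlgebra p (maxNorm ρ) := by
  have := hS.finite_map
  refine hS.unitBallIsPadicOperatorAlgebra hp
    (O := fun m => S.map (Ideal.Quotient.mkₐ ℤ_[p] m.asIdeal))
    (B := ⨅ m : MaximalSpectrum A,
      (S.map (Ideal.Quotient.mkₐ ℤ_[p] m.asIdeal)).comap (Ideal.Quotient.mkₐ ℤ_[p] m.asIdeal))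
    (fun m s hs => ⟨s, hs, rfl⟩) (fun a => ?_) ?_
  · rw [Algebra.mem_iInf]; rfl
  · rw [Algebra.iInf_toSubmodule]
    exact IsLatticeNorm.iSup (fun m => hρ.classNorm m) hρ.bddAbove_classNorm

/-- The elements of spectral norm at most one are the integral ones. -/
theorem spectralNorm_le_one_iff {L : Type*} [Field L] [Algebra ℚ_[p] L] [Algebra ℤ_[p] L]
    [IsScalarTower ℤ_[p] ℚ_[p] L] [Algebra.IsAlgebraic ℚ_[p] L] (x : L) :
    spectralNorm ℚ_[p] L x ≤ 1 ↔ IsIntegral ℤ_[p] x := by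
  have hx : IsIntegral ℚ_[p] x := (Algebra.IsAlgebraic.isAlgebraic x).isIntegral
  rw [spectralNorm, spectralValue_le_one_iff (minpoly.monic hx)]
  -- Both sides say that the minimal polynomial over `ℚ_p` has coefficients in `ℤ_p`; for integral
  -- elements this holds because `ℤ_p` is integrally closed.
  constructor
  · intro h
    have hl : minpoly ℚ_[p] x ∈ Polynomial.lifts (algebraMap ℤ_[p] ℚ_[p]) := by
      rw [Polynomial.lifts_iff_coeff_lifts]
      exact fun i => ⟨⟨_, h i⟩, rfl⟩
    obtain ⟨q, hq, -, hmonic⟩ := Polynomial.lifts_and_degree_eq_and_monic hl (minpoly.monic hx)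
    refine ⟨q, hmonic, ?_⟩
    rw [← Polynomial.aeval_def, ← Polynomial.aeval_map_algebraMap ℚ_[p], hq, minpoly.aeval]
  · intro h i
    rw [minpoly.isIntegrallyClosed_eq_field_fractions' ℚ_[p] h, Polynomial.coeff_map]
    exact ((minpoly ℤ_[p] x).coeff i).2

theorem IsModel.finiteDimensional_quotient (hS : IsModel p S A) (m : MaximalSpectrum A) :
    FiniteDimensional ℚ_[p] (A ⧸ m.asIdeal) := by
  have hfin := hS.finite_map m
  obtain ⟨s, hs⟩ := (Module.Finite.iff_fg.1 hfin : (Subalgebra.toSubmodule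
    (S.map (Ideal.Quotient.mkₐ ℤ_[p] m.asIdeal))).FG)
  refine ⟨⟨s, eq_top_iff.2 fun x _ => ?_⟩⟩
  obtain ⟨a, rfl⟩ := Ideal.Quotient.mk_surjective x
  obtain ⟨k, b, hb⟩ := hS.exists_pow a
  have h1 : (p : ℚ_[p]) ^ k • Ideal.Quotient.mk m.asIdeal a = Ideal.Quotient.mk m.asIdeal b := by
    rw [← prime_pow_mul_eq_smul, ← map_natCast (Ideal.Quotient.mk m.asIdeal), ← map_pow, ← map_mul,
      hb]
    rfl
  have h2 : Ideal.Quotient.mk m.asIdeal b ∈ Submodule.span ℤ_[p] (s : Set (A ⧸ m.asIdeal)) := by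
    rw [hs]
    exact ⟨b, b.2, rfl⟩
  have h3 : Ideal.Quotient.mk m.asIdeal b ∈ Submodule.span ℚ_[p] (s : Set (A ⧸ m.asIdeal)) :=
    Submodule.span_subset_span ℤ_[p] ℚ_[p] _ h2
  rw [← h1] at h3
  have := Submodule.smul_mem _ ((p : ℚ_[p]) ^ k)⁻¹ h3
  rwa [smul_smul, inv_mul_cancel₀ (pow_ne_zero k prime_ne_zero_padic), one_smul] at this

theorem IsModel.classAbs_le_iff (hS : IsModel p S A) (m : MaximalSpectrum A) (f : A) (k : ℤ) :
    classAbs p m f ≤ (p : ℝ) ^ k ↔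
      Ideal.Quotient.mk m.asIdeal ((p : ℚ_[p]) ^ k • f) ∈
        integralClosure ℤ_[p] (A ⧸ m.asIdeal) := by
  have := hS.finiteDimensional_quotient m
  have := m.isMaximal
  let := Ideal.Quotient.field m.asIdeal
  have hpos : (0 : ℝ) < (p : ℝ) ^ k := zpow_pos (zero_lt_one.trans one_lt_prime_real) _
  have hsm : Ideal.Quotient.mk m.asIdeal ((p : ℚ_[p]) ^ k • f) =
      (p : ℚ_[p]) ^ k • Ideal.Quotient.mk m.asIdeal f :=
    map_smul (Ideal.Quotient.mkₐ ℚ_[p] m.asIdeal) _ _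
  rw [mem_integralClosure_iff, hsm, ← spectralNorm_le_one_iff (p := p),
    spectralNorm_smul _ (Algebra.IsAlgebraic.isAlgebraic _), coe_nnnorm, norm_zpow, Padic.norm_p,
    inv_zpow, inv_mul_le_iff₀ hpos, mul_one]
  rfl

theorem IsModel.mk_mem_integralClosure (hS : IsModel p S A) (m : MaximalSpectrum A) {s : A}
    (hs : s ∈ S) : Ideal.Quotient.mk m.asIdeal s ∈ integralClosure ℤ_[p] (A ⧸ m.asIdeal) := by
  have := hS.finite_map m
  exact (Algebra.IsIntegral.isIntegral (R := ℤ_[p])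
    (⟨_, s, hs, rfl⟩ : S.map (Ideal.Quotient.mkₐ ℤ_[p] m.asIdeal))).map (Subalgebra.val _)

theorem IsModel.finite_integralClosure (hS : IsModel p S A) (m : MaximalSpectrum A) :
    Module.Finite ℤ_[p] (integralClosure ℤ_[p] (A ⧸ m.asIdeal)) := by
  have := hS.finiteDimensional_quotient m
  have := m.isMaximal
  let := Ideal.Quotient.field m.asIdeal
  exact IsIntegralClosure.finite ℤ_[p] ℚ_[p] (A ⧸ m.asIdeal) _

theorem IsModel.bddAbove_classAbs (hS : IsModel p S A) (f : A) :
    BddAbove (Set.range fun m => classAbs p m f) := by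
  obtain ⟨k, s, hs⟩ := hS.exists_pow f
  refine ⟨(p : ℝ) ^ (k : ℤ), ?_⟩
  rintro _ ⟨m, rfl⟩
  refine (hS.classAbs_le_iff m f k).2 (hS.mk_mem_integralClosure m ?_)
  rw [zpow_natCast, ← prime_pow_mul_eq_smul, hs]
  exact s.2

/-- Here O_𝔪 is the full ring of integers of A/𝔪. Ramified residue fields can produce fractional
powers of p, so the values are discrete powers of p only by the hypothesis `h`. -/
theorem IsModel.unitBall_spectralSeminorm (hp : p ≠ 2) (hS : IsModel p S A) [IsReduced A]
    (h : ∀ f : A, ∃ c : ℚ_[p], ‖c‖ = spectralSeminorm p f) :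
    UnitBallIsPadicOperatorAlgebra p (spectralSeminorm (R := A) p) := by
  have := hS.finite_integralClosure
  refine hS.unitBallIsPadicOperatorAlgebra hp
    (O := fun m => integralClosure ℤ_[p] (A ⧸ m.asIdeal))
    (B := ⨅ m : MaximalSpectrum A,
      (integralClosure ℤ_[p] (A ⧸ m.asIdeal)).comap (Ideal.Quotient.mkₐ ℤ_[p] m.asIdeal))
    (fun m s hs => hS.mk_mem_integralClosure m hs) (fun a => ?_) ⟨fun a => ?_, fun a k => ?_⟩
  · rw [Algebra.mem_iInf]; rfl
  · obtain ⟨c, hc⟩ := h a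
    rw [← hc]
    exact isLatticeNorm_padic.values c
  · rw [Subalgebra.mem_toSubmodule, Algebra.mem_iInf]
    constructor
    · exact fun hk m => (hS.classAbs_le_iff m a k).1
        ((le_ciSup (hS.bddAbove_classAbs a) m).trans hk)
    · exact fun hk => Real.iSup_le (fun m => (hS.classAbs_le_iff m a k).2 (hk m)) (by positivity)

theorem isModel_range {T : Type*} [CommRing T] [Algebra ℤ_[p] T] (hT : IsTopFinite p T)
    (f : T →ₐ[ℤ_[p]] A) (h : IsLatticeNorm (Subalgebra.toSubmodule f.range) ρ) :
    IsModel p f.range A where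
  topFinite := hT.of_surjective _ f.rangeRestrict_surjective
  injective := Subtype.val_injective
  exists_pow a := by
    obtain ⟨k, hk⟩ := pow_unbounded_of_one_lt (ρ a) (one_lt_prime_real (p := p))
    refine ⟨k, ⟨(p : A) ^ k * a, ?_⟩, rfl⟩
    rw [prime_pow_mul_eq_smul (p := p)]
    rw [← zpow_natCast, ← Subalgebra.mem_toSubmodule, ← h.le_iff, zpow_natCast]
    exact hk.le

theorem unitBalls_of_range {T : Type*} [CommRing T] [Algebra ℤ_[p] T] [IsReduced A]
    (hp : p ≠ 2) (hT : IsTopFinite p T) (f : T →ₐ[ℤ_[p]] A)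
    (h : IsLatticeNorm (Subalgebra.toSubmodule f.range) ρ) :
    ((Nontrivial A → ∀ a : A,
        IsGreatest (Set.range fun m => PadicOpAlg.classNorm ρ m a) (maxNorm ρ a)) ∧
      UnitBallIsPadicOperatorAlgebra p (maxNorm ρ)) ∧
    ((∀ a : A, ∃ c : ℚ_[p], ‖c‖ = spectralSeminorm p a) →
      UnitBallIsPadicOperatorAlgebra p (spectralSeminorm (R := A) p)) := by
  have hS := isModel_range hT f h
  exact ⟨⟨fun _ => h.isGreatest_maxNorm, hS.unitBall_maxNorm hp h⟩,
    hS.unitBall_spectralSeminorm hp⟩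

end Points

end PadicOpAlg

end

theorem mainTheorem3 (p : ℕ) [Fact p.Prime] (hp : p ≠ 2) (n : ℕ)
    (I : Ideal (PadicOpAlg.TateAlgebra p n)) (hA : IsReduced (PadicOpAlg.AffinoidAlgebra I)) :
    ((Nontrivial (PadicOpAlg.AffinoidAlgebra I) → ∀ f : PadicOpAlg.AffinoidAlgebra I,
        IsGreatest
          (Set.range fun m => PadicOpAlg.classNorm (PadicOpAlg.residueNorm I) m f)
          (PadicOpAlg.maxNorm (PadicOpAlg.residueNorm I) f)) ∧
      PadicOpAlg.UnitBallIsPadicOperatorAlgebra p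
        (PadicOpAlg.maxNorm (PadicOpAlg.residueNorm I))) ∧
    ((∀ f : PadicOpAlg.AffinoidAlgebra I,
        ∃ c : ℚ_[p], ‖c‖ = PadicOpAlg.spectralSeminorm p f) →
      PadicOpAlg.UnitBallIsPadicOperatorAlgebra p
        (PadicOpAlg.spectralSeminorm (R := PadicOpAlg.AffinoidAlgebra I) p)) := by
  exact PadicOpAlg.unitBalls_of_range hp (PadicOpAlg.RestrictedSeries.isTopFinite_padicInt (Fin n))
    (PadicOpAlg.toAffinoid I) (PadicOpAlg.isLatticeNorm_residueNorm I)
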